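/- **Setting.** Let $\mathcal T=(S,s_{init},R,AP,L)$ be a finite labeled transition system with $R\subseteq S\times S$, let $\Phi=(\phi_1,\dots,\phi_n)$ be LTL formulas over $AP$, and let $rew(\phi_i)\in\mathbb N$ be their rewards. The size $|\mathcal T|$ is the number of states plus the number of transitions; $|\phi|$ is the number of operators ($\neg,\wedge,\mathsf X,\mathsf U$) in $\phi$, and $|\Phi|=\sum_i|\phi_i|$; $n_0$ is the number of indices $i$ such that $\phi_i$ contains no operator ($n_0=0$ in the typical case). Given non-blocking generalized Büchi automata $\mathcal G_i=(Q_i,q_{init,i},2^{AP},\delta_i,\{F_i^1,\dots,F_i^{m_i}\})$ with $m_i\ge 1$, the weighted Büchi automaton $\mathcal B$ has the states $Q_1\times\dots\times Q_n\times(\{(j,l):1\le j\le n,\,1\le l\le m_j\}\cup\{(0,0)\})$ and the initial state $(q_{init,1},\dots,q_{init,n},(0,0))$. Its accepting states are those with last entry (component) $(0,0)$. Its transitions under $\sigma$ from $(q_1,\dots,q_n,c)$ to $(q_1',\dots,q_n',c')$ require $(q_i,\sigma,q_i')\in\delta_i$ for all $i$ and one of the following: $c=c'=(0,0)$; or $c=(0,0)$,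 $c'=(j',1)$; or $c=c'=(j,l)$, $q_j\notin F_j^l$; or $c=(j,l)$, $l<m_j$, $c'=(j,l+1)$, $q_j\in F_j^l$; or $c=(j,m_j)$, $c'=(j',1)$, $j<j'$, $q_j\in F_j^{m_j}$; or $c=(j,m_j)$, $c'=(0,0)$, $q_j\in F_j^{m_j}$. A transition that enters $(j',1)$ from $(0,0)$ or from $(j,m_j)$ with $j<j'$ has weight $rew(\phi_{j'})$, every other transition has weight $0$. The product $\mathcal P=\mathcal T\otimes\mathcal B$ has the states $S\times Q_{\mathcal B}$, a transition $(s,q)\to(s',q')$ if $(s,s')\in R$ and $(q,L(s),q')\in\delta_{\mathcal B}$, with the weight of the latter, and the accepting states $S\times F_{\mathcal B}$; $|\mathcal P|$ is its number of states plus its number of transitions. Algorithm 1 is the weighted nested depth-first search on $\mathcal P$. An outer depth-first search from the initial state starts, whenever it leaves an accepting state $p_f$, a search for a cycle from $p_f$ with a first fragment of large weight. This search propagates values $p.dist$ from $p_f$ through the layers $j=1,\dots,n$, skipping states already processed in earlier searches. It sorts the states of component $(0,0)$ reached in this way by decreasing $dist$, and looks from each of them in turn for a path back to $p_f$ that avoids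 all states visited by earlier such path searches. The best stem and cycle found are projected to $\mathcal T$; if there are none, an arbitrary trace of $\mathcal T$ is returned (if one exists). The outer search stops early once the best weight equals a fixed threshold. $\mathcal P$ and $\mathcal T$ are given by lists of states and of successors. Time is the number of steps of this program, each consisting of boundedly many unit-cost operations on numbers, array cells, bit-array sets and linked lists; recording the current stack of the outer search is the assignment of a reference, and the stack is reversed once, when the run is returned. **Theorem.** 1. There is a constant $C$ such that for all $\mathcal T$, $n$, non-blocking $\mathcal G_1,\dots,\mathcal G_n$ with $m_i\ge1$ and rewards with $|\mathcal P|\ge2$, for all orders in which states and successors are listed, and for every threshold, Algorithm 1 halts on $\mathcal P$ after at most $C\,|\mathcal P|\log|\mathcal P|$ steps. 2. For every LTL formula $\phi$, the tableau automaton of $\phi$ (states: the sets of subformulas of $\phi$, and an initial state; acceptance sets: the set of all states, and one set for each until-subformula), completed by a sink, is a non-blocking generalized Büchi automaton $\mathcal G_\phi$ with at least one acceptance set that accepts exactly the words satisfying $\phi$. 3. There is a constant $C$ such that for all $\mathcal T$, $\Phi$ and rewards, the product $\mathcal P$ built from $\mathcal G_{\phi_1},\dots,\mathcal G_{\phi_n}$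 satisfies $|\mathcal P|\le C\,|\mathcal T|\,2^{C(|\Phi|+n_0)}$. In particular $|\mathcal P|$ is in $O(|\mathcal T|\cdot2^{O(|\Phi|)})$ if every $\phi_i$ contains at least one operator. -/

import Mathlib

universe u v w

/-! ### Transition systems and linear temporal logic -/

/-- A finite labeled transition system. A transition is a pair of states, and the controller chooses
among the outgoing transitions of the current state. -/
structure TransitionSystem (AP : Type u) where
  S : Type v
  finite : Finite S
  start : S
  R : S → S → Prop
  label : S → Set AP

/-- The size of a transition system: number of states plus number of transitions. -/
noncomputable def TransitionSystem.size {AP : Type u} (T : TransitionSystem.{u, v} AP) : ℕ :=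
  Nat.card T.S + Nat.card {e : T.S × T.S // T.R e.1 e.2}

inductive LTL (AP : Type u) : Type u
  | top : LTL AP
  | atom : AP → LTL AP
  | neg : LTL AP → LTL AP
  | and : LTL AP → LTL AP → LTL AP
  | next : LTL AP → LTL AP
  | untl : LTL AP → LTL AP → LTL AP

namespace LTL

/-- `φ.Sat w i`: the suffix `w(i) w(i+1) …` of the word `w` over `2^AP` satisfies `φ`. -/
def Sat {AP : Type u} (w : ℕ → Set AP) : LTL AP → ℕ → Prop
  | top, _ => True
  | atom a, i => a ∈ w i
  | neg φ, i => ¬ Sat w φ i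
  | and φ ψ, i => Sat w φ i ∧ Sat w ψ i
  | next φ, i => Sat w φ (i + 1)
  | untl φ ψ, i => ∃ k, i ≤ k ∧ Sat w ψ k ∧ ∀ j, i ≤ j → j < k → Sat w φ j

/-- The size of a formula: the number of operators present in it. -/
def size {AP : Type u} : LTL AP → ℕ
  | top => 0
  | atom _ => 0
  | neg φ => φ.size + 1
  | and φ ψ => φ.size + ψ.size + 1
  | next φ => φ.size + 1
  | untl φ ψ => φ.size + ψ.size + 1

/-- The set of subformulas, the formula itself included. -/
def sub {AP : Type u} : LTL AP → Set (LTL AP)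
  | top => {top}
  | atom a => {atom a}
  | neg φ => insert (neg φ) φ.sub
  | and φ ψ => insert (and φ ψ) (φ.sub ∪ ψ.sub)
  | next φ => insert (next φ) φ.sub
  | untl φ ψ => insert (untl φ ψ) (φ.sub ∪ ψ.sub)

theorem finite_sub {AP : Type u} (φ : LTL AP) : φ.sub.Finite := by
  induction φ with
  | top => exact Set.finite_singleton _
  | atom a => exact Set.finite_singleton _
  | neg φ ih => exact ih.insert _
  | and φ ψ ih₁ ih₂ => exact (ih₁.union ih₂).insert _
  | next φ ih => exact ih.insert _
  | untl φ ψ ih₁ ih₂ => exact (ih₁.union ih₂).insert _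

/-- The list of (the pairs of arguments of) the occurrences of until-subformulas. -/
def untils {AP : Type u} : LTL AP → List (LTL AP × LTL AP)
  | top => []
  | atom _ => []
  | neg φ => φ.untils
  | and φ ψ => φ.untils ++ ψ.untils
  | next φ => φ.untils
  | untl φ ψ => (φ, ψ) :: (φ.untils ++ ψ.untils)

end LTL

/-! ### Generalized Büchi automata and the translation of LTL formulas -/

/-- A generalized Büchi automaton over the alphabet `A`, with acceptance sets `acc 0, …, acc (m-1)`. -/
structure GBA (A : Type u) where
  Q : Type w
  finite : Finite Q
  start : Q
  δ : Q → A → Q → Prop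
  m : ℕ
  acc : Fin m → Set Q

namespace GBA

def NonBlocking {A : Type u} (G : GBA.{u, w} A) : Prop :=
  ∀ q σ, ∃ q', G.δ q σ q'

def language {A : Type u} (G : GBA.{u, w} A) : Set (ℕ → A) :=
  {x | ∃ ρ : ℕ → G.Q, ρ 0 = G.start ∧ (∀ i, G.δ (ρ i) (x i) (ρ (i + 1))) ∧
    ∀ k : Fin G.m, ∀ N, ∃ i, N ≤ i ∧ ρ i ∈ G.acc k}

/-- Completion to a non-blocking automaton: a new state `none` is the target of a transition from
`q` under `σ` if `q` has no other transition under `σ`. -/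
def complete {A : Type u} (G : GBA.{u, w} A) : GBA.{u, w} A where
  Q := Option G.Q
  finite := by
    have := G.finite
    infer_instance
  start := some G.start
  δ q σ q' := match q, q' with
    | some q, some q' => G.δ q σ q'
    | some q, none => ¬ ∃ q', G.δ q σ q'
    | none, some _ => False
    | none, none => True
  m := G.m
  acc k := some '' G.acc k

end GBA

namespace LTL

/-- The local consistency conditions of the tableau of `φ₀`: `B` is the set of subformulas claimed at
a position with letter `σ`, and `B'` the one claimed at the following position. -/
def Consistent {AP : Type u} (φ₀ : LTL AP) (B : Set φ₀.sub) (σ : Set AP) (B' : Set φ₀.sub) : Prop :=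
  let holds : LTL AP → Prop := fun ψ => ∃ h : ψ ∈ φ₀.sub, (⟨ψ, h⟩ : φ₀.sub) ∈ B
  let holds' : LTL AP → Prop := fun ψ => ∃ h : ψ ∈ φ₀.sub, (⟨ψ, h⟩ : φ₀.sub) ∈ B'
  ∀ ψ ∈ φ₀.sub, (holds ψ ↔ match ψ with
    | top => True
    | atom a => a ∈ σ
    | neg χ => ¬ holds χ
    | and χ₁ χ₂ => holds χ₁ ∧ holds χ₂
    | next χ => holds' χ
    | untl χ₁ χ₂ => holds χ₂ ∨ (holds χ₁ ∧ holds' (untl χ₁ χ₂)))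

/-- The tableau automaton of `φ₀`. Its states are the sets of subformulas of `φ₀` and an additional
initial state `none`. There is one acceptance set for each until-subformula, preceded by the
set of all states. -/
def tableau {AP : Type u} (φ₀ : LTL AP) : GBA.{u, u} (Set AP) where
  Q := Option (Set φ₀.sub)
  finite := by
    have : Finite φ₀.sub := φ₀.finite_sub
    infer_instance
  start := none
  δ q σ q' := match q, q' with
    | some B, some B' => φ₀.Consistent B σ B'
    | none, some B' => ∃ B, (∃ h : φ₀ ∈ φ₀.sub, (⟨φ₀, h⟩ : φ₀.sub) ∈ B) ∧ φ₀.Consistent B σ B'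
    | _, none => False
  m := φ₀.untils.length + 1
  acc := Fin.cases Set.univ fun k =>
    {q | ∃ B : Set φ₀.sub, q = some B ∧
      ((∃ h : untl (φ₀.untils.get k).1 (φ₀.untils.get k).2 ∈ φ₀.sub,
          (⟨_, h⟩ : φ₀.sub) ∈ B) →
        ∃ h : (φ₀.untils.get k).2 ∈ φ₀.sub, (⟨_, h⟩ : φ₀.sub) ∈ B)}

/-- The translation of a formula into a non-blocking generalized Büchi automaton. -/
def toGBA {AP : Type u} (φ : LTL AP) : GBA.{u, u} (Set AP) := φ.tableau.complete

end LTL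

/-! ### The weighted Büchi automaton and the weighted product automaton -/

/-- A Büchi automaton over `A` with weighted transitions; `W` matters on the transitions only. -/
structure WeightedBuchi (A : Type u) where
  Q : Type w
  finite : Finite Q
  start : Q
  δ : Q → A → Q → Prop
  F : Set Q
  W : Q → A → Q → ℕ

/-- The components: `none` is `(0,0)`, and `some ⟨j, l⟩` is the `(l+1)`-st component of the layer of
the `(j+1)`-st formula. -/
abbrev Component {A : Type u} {n : ℕ} (G : Fin n → GBA.{u, w} A) : Type :=
  Option (Σ j : Fin n, Fin (G j).m)

/-- The layer of a component: `0` for `(0,0)`, and `j` for `(j, l)` with `1 ≤ j ≤ n`. -/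
def Component.layer {A : Type u} {n : ℕ} {G : Fin n → GBA.{u, w} A} : Component G → ℕ
  | none => 0
  | some c => c.1.val + 1

/-- The possible changes of the component on a transition with source states `q 0, …, q (n-1)`. -/
def Component.Move {A : Type u} {n : ℕ} {G : Fin n → GBA.{u, w} A} (q : ∀ i, (G i).Q) :
    Component G → Component G → Prop
  | none, none => True
  | none, some ⟨_, l'⟩ => l'.val = 0
  | some ⟨j, l⟩, some ⟨j', l'⟩ =>
      (j' = j ∧ l'.val = l.val ∧ q j ∉ (G j).acc l) ∨
      (j' = j ∧ l'.val = l.val + 1 ∧ q j ∈ (G j).acc l) ∨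
      (l.val + 1 = (G j).m ∧ j < j' ∧ l'.val = 0 ∧ q j ∈ (G j).acc l)
  | some ⟨j, l⟩, none => l.val + 1 = (G j).m ∧ q j ∈ (G j).acc l

/-- Entering a layer from another one earns the reward of its formula; all other weights are `0`. -/
def Component.weight {A : Type u} {n : ℕ} {G : Fin n → GBA.{u, w} A} (rew : Fin n → ℕ) :
    Component G → Component G → ℕ
  | _, none => 0
  | none, some ⟨j', _⟩ => rew j'
  | some ⟨j, _⟩, some ⟨j', _⟩ => if j = j' then 0 else rew j'

def weightedBuchi {A : Type u} {n : ℕ} (G : Fin n → GBA.{u, w} A) (rew : Fin n → ℕ) :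
    WeightedBuchi.{u, w} A where
  Q := (∀ i, (G i).Q) × Component G
  finite := by
    have := fun i => (G i).finite
    infer_instance
  start := (fun i => (G i).start, none)
  δ q σ q' := (∀ i, (G i).δ (q.1 i) σ (q'.1 i)) ∧ Component.Move q.1 q.2 q'.2
  F := {q | q.2 = none}
  W q _ q' := Component.weight rew q.2 q'.2

/-- A weighted Büchi automaton with trivial alphabet. -/
structure WeightedProduct where
  Q : Type w
  finite : Finite Q
  start : Q
  δ : Q → Q → Prop
  F : Set Q
  W : Q → Q → ℕ

/-- The size of a product automaton: number of states plus number of transitions. -/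
noncomputable def WeightedProduct.size (P : WeightedProduct.{w}) : ℕ :=
  Nat.card P.Q + Nat.card {e : P.Q × P.Q // P.δ e.1 e.2}

def product {AP : Type u} (T : TransitionSystem.{u, v} AP) (B : WeightedBuchi.{u, w} (Set AP)) :
    WeightedProduct.{max v w} where
  Q := T.S × B.Q
  finite := by
    have := T.finite
    have := B.finite
    infer_instance
  start := (T.start, B.start)
  δ p p' := T.R p.1 p'.1 ∧ B.δ p.2 (T.label p.1) p'.2
  F := {p | p.2 ∈ B.F}
  W p p' := B.W p.2 (T.label p.1) p'.2

/-- The weighted product automaton `T ⊗ B` of the specifications given by the automata `G i` with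
rewards `rew i`. -/
def missionProduct {AP : Type u} {n : ℕ} (T : TransitionSystem.{u, v} AP)
    (G : Fin n → GBA.{u, w} (Set AP)) (rew : Fin n → ℕ) : WeightedProduct.{max v w} :=
  product T (weightedBuchi G rew)

/-! ### The weighted nested depth-first search as a program with a step count

The program is given by its control points (`Line`), its memory (`Mem`) and a function `step` that
executes one control point. A step makes a bounded number of elementary operations of a
unit-cost random access machine: tests, arithmetic on weights, access to an array that is indexed by
states, test and insertion for a set of states that is kept as a bit array, insertion and
removal at an end of a linked list, assignment of a reference to a list, and concatenation of two
linked lists that are not used afterwards. Everything else is a loop. The outer stack is an immutable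
linked list, so that the best stem is recorded by a reference to it; this list is reversed element by
element when the run is returned. The set `visited_ps` is shared by all path searches. -/

/-- An enumeration, without repetition, of the successors of every vertex. -/
structure AdjacencyLists {V : Type w} (E : V → V → Prop) where
  succ : V → List V
  nodup : ∀ p, (succ p).Nodup
  mem_succ : ∀ p p', p' ∈ succ p ↔ E p p'

/-- An enumeration, without repetition, of all elements. -/
structure Listing (V : Type w) where
  list : List V
  nodup : list.Nodup
  mem_list : ∀ p, p ∈ list

namespace WeightedNestedDFS

/-- The input of the program; `V` is the type of states of the product automaton. -/
structure Input (V : Type w) (S : Type v) where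
  /-- number of specifications -/
  n : ℕ
  states : List V
  start : V
  succ : V → List V
  weight : V → V → ℕ
  accepting : V → Prop
  /-- the layer of the component of a state, `0` for the component `(0,0)` -/
  layer : V → ℕ
  /-- the projection to the transition system -/
  proj : V → S
  tstart : S
  tsucc : S → List S
  /-- the search ends early once `weight_max` has this value -/
  threshold : ℕ

/-- The control points. -/
inductive Line
  | setup
  | dfsStart
  | dfsScan
  | dfsRepeat
  | cycleStart
  | clearQueues
  | propPop
  | propSucc
  | propRepeat
  | nextLayer
  | sortSplit
  | sortTake
  | sortMerge
  | tryNext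
  | pathStart
  | pathScan
  | pathBuild
  | cycleFound
  | predWalk
  | cycleConcat
  | cycleDone
  | returnRun
  | projStem
  | projCycle
  | traceStart
  | traceScan
  | traceCycle
  | traceStem
  | halt

structure Mem (V : Type w) (S : Type v) where
  pc : Line
  todo : List V
  weight_max : ℕ
  /-- reference to the stack whose reversal is the stem of the best run -/
  stem_max : List V
  cycle_max : List V
  stack_outer : List V
  visited_outer : Finset V
  visited_inner : Finset V
  /-- the states visited by the searches for a path back to the accepting state -/
  visited_ps : Finset V
  dist : V → ℕ
  pred : V → Option V
  /-- the successors of a state that the outer search has not scanned yet -/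
  unscanned : V → List V
  /-- the accepting state from which a cycle is sought -/
  p_f : V
  /-- loop counter over the layers -/
  idx : ℕ
  queue_curr : List V
  queues_all : ℕ → List V
  search_from : List V
  /-- the accepting state in whose search the state was last put into `search_from` -/
  stamp : V → Option V
  /-- the current state `p` -/
  cur : V
  /-- the successors of `cur` that remain to be treated -/
  succs : List V
  /-- the sorted lists that the current pass of the sort still has to merge, in pairs -/
  runs : List (List V)
  /-- the sorted lists that the current pass of the sort has made -/
  merged : List (List V)
  left : List V
  right : List V
  out : List V
  path_stack : List V
  path_unscanned : V → List V
  path_suf : List V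
  path_pref : List V
  cycle : List V
  tstack : List S
  tvisited : Finset S
  tonstack : Finset S
  tunscanned : S → List S
  tclose : S
  /-- the returned trace is `stem_out · cycle_out^ω`, where a cycle is listed with its first state
  repeated at the end; if `cycle_out` is empty, there is no trace -/
  stem_out : List S
  cycle_out : List S

section Program

variable {V : Type w} {S : Type v}

/-- The memory at the start of the program. -/
def initial (I : Input V S) : Mem V S where
  pc := .setup
  todo := I.states
  weight_max := 0
  stem_max := []
  cycle_max := []
  stack_outer := []
  visited_outer := ∅
  visited_inner := ∅
  visited_ps := ∅
  dist := fun _ => 0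
  pred := fun _ => none
  unscanned := fun _ => []
  p_f := I.start
  idx := 0
  queue_curr := []
  queues_all := fun _ => []
  search_from := []
  stamp := fun _ => none
  cur := I.start
  succs := []
  runs := []
  merged := []
  left := []
  right := []
  out := []
  path_stack := []
  path_unscanned := fun _ => []
  path_suf := []
  path_pref := []
  cycle := []
  tstack := []
  tvisited := ∅
  tonstack := ∅
  tunscanned := fun _ => []
  tclose := I.tstart
  stem_out := []
  cycle_out := []

open Classical in
/-- Execution of one control point. -/
noncomputable def step (I : Input V S) (m : Mem V S) : Mem V S :=
  match m.pc with
  -- main procedure: for all states p, reset p.dist and p.pred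
  | .setup => match m.todo with
    | p :: ps => { m with
        todo := ps
        dist := Function.update m.dist p 0
        pred := Function.update m.pred p none
        stamp := Function.update m.stamp p none }
    | [] => { m with pc := .dfsStart }
  -- outer search: push the initial state
  | .dfsStart => { m with
      stack_outer := [I.start]
      visited_outer := {I.start}
      unscanned := Function.update m.unscanned I.start (I.succ I.start)
      pc := .dfsScan }
  -- look for a successor of the top state that is not in visited_outer
  | .dfsScan => match m.stack_outer with
    | [] => { m with pc := .returnRun }
    | p :: st => match m.unscanned p with
      | x :: xs =>
        if x ∈ m.visited_outer then
          { m with unscanned := Function.update m.unscanned p xs }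
        else
          { m with
            unscanned := Function.update (Function.update m.unscanned p xs) x (I.succ x)
            stack_outer := x :: m.stack_outer
            visited_outer := insert x m.visited_outer
            pc := .dfsRepeat }
      | [] =>
        if I.accepting p then
          { m with
            stack_outer := st
            dist := Function.update m.dist p 0
            pred := Function.update m.pred p none
            p_f := p
            pc := .cycleStart }
        else
          { m with stack_outer := st, pc := .dfsRepeat }
  -- until stack_outer is empty or weight_max has the value at which the search ends
  | .dfsRepeat =>
    if m.stack_outer = [] ∨ m.weight_max = I.threshold then { m with pc := .returnRun }
    else { m with pc := .dfsScan }
  -- search for a cycle from p_f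
  | .cycleStart => { m with queue_curr := [m.p_f], idx := 1, pc := .clearQueues }
  | .clearQueues =>
    if m.idx ≤ I.n then
      { m with queues_all := Function.update m.queues_all m.idx [], idx := m.idx + 1 }
    else { m with search_from := [], idx := 0, pc := .propPop }
  -- propagation of distances
  | .propPop => match m.queue_curr with
    | [] => { m with pc := .nextLayer }
    | p :: qs =>
      if p ∈ m.visited_inner then { m with queue_curr := qs, pc := .propRepeat }
      else
        { m with
          queue_curr := qs
          visited_inner := insert p m.visited_inner
          cur := p
          succs := I.succ p
          pc := .propSucc }
  | .propSucc => match m.succs with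
    | [] => { m with pc := .propRepeat }
    | x :: xs =>
      let d := m.dist m.cur + I.weight m.cur x
      if m.dist x < d then
        { m with
          succs := xs
          dist := Function.update m.dist x d
          pred := Function.update m.pred x (some m.cur)
          search_from := if I.layer x = 0 ∧ m.stamp x ≠ some m.p_f
            then x :: m.search_from else m.search_from
          stamp := if I.layer x = 0 ∧ m.stamp x ≠ some m.p_f
            then Function.update m.stamp x (some m.p_f) else m.stamp
          queue_curr := if I.layer x = I.layer m.cur then m.queue_curr ++ [x] else m.queue_curr
          queues_all := if I.layer x ≠ I.layer m.cur ∧ 1 ≤ I.layer x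
            then Function.update m.queues_all (I.layer x) (m.queues_all (I.layer x) ++ [x])
            else m.queues_all }
      else { m with succs := xs }
  | .propRepeat =>
    if m.queue_curr = [] then { m with pc := .nextLayer } else { m with pc := .propPop }
  -- for all layers with a nonempty queue, propagate from that queue
  | .nextLayer =>
    if m.idx < I.n then
      if m.queues_all (m.idx + 1) = [] then { m with idx := m.idx + 1, queue_curr := [] }
      else { m with
        idx := m.idx + 1, queue_curr := m.queues_all (m.idx + 1), pc := .propPop }
    else { m with runs := [], merged := [], pc := .sortSplit }
  -- order search_from decreasingly according to dist, by bottom-up merge sort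
  | .sortSplit => match m.search_from with
    | p :: ps => { m with search_from := ps, runs := [p] :: m.runs }
    | [] => { m with pc := .sortTake }
  | .sortTake => match m.runs, m.merged with
    | r₁ :: r₂ :: rs, _ => { m with left := r₁, right := r₂, out := [], runs := rs, pc := .sortMerge }
    | [r], _ => { m with runs := [], merged := r :: m.merged }
    | [], r :: r' :: rs => { m with runs := r :: r' :: rs, merged := [] }
    | [], [r] => { m with search_from := r, merged := [], pc := .tryNext }
    | [], [] => { m with search_from := [], pc := .tryNext }
  | .sortMerge => match m.left, m.right with
    | a :: l, b :: r =>
      if m.dist b ≤ m.dist a then { m with left := l, out := m.out ++ [a] }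
      else { m with right := r, out := m.out ++ [b] }
    | a :: l, [] => { m with left := l, out := m.out ++ [a] }
    | [], b :: r => { m with right := r, out := m.out ++ [b] }
    | [], [] => { m with merged := m.out :: m.merged, pc := .sortTake }
  -- while search_from is nonempty
  | .tryNext => match m.search_from with
    | [] => { m with cycle := [], pc := .cycleDone }
    | p :: ps => { m with search_from := ps, cur := p, pc := .pathStart }
  -- find a path from p to p_f, by a depth-first search that does not enter visited_ps
  | .pathStart =>
    if m.cur = m.p_f then { m with path_suf := [m.p_f], pc := .cycleFound }
    else if m.cur ∈ m.visited_ps then { m with pc := .tryNext }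
    else
      { m with
        visited_ps := insert m.cur m.visited_ps
        path_stack := [m.cur]
        path_unscanned := Function.update m.path_unscanned m.cur (I.succ m.cur)
        pc := .pathScan }
  | .pathScan => match m.path_stack with
    | [] => { m with pc := .tryNext }
    | p :: st => match m.path_unscanned p with
      | [] => { m with path_stack := st }
      | x :: xs =>
        if x = m.p_f then { m with path_suf := [m.p_f], pc := .pathBuild }
        else if x ∈ m.visited_ps then
          { m with path_unscanned := Function.update m.path_unscanned p xs }
        else
          { m with
            path_unscanned := Function.update (Function.update m.path_unscanned p xs) x (I.succ x)
            path_stack := x :: m.path_stack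
            visited_ps := insert x m.visited_ps }
  | .pathBuild => match m.path_stack with
    | p :: st => { m with path_suf := p :: m.path_suf, path_stack := st }
    | [] => { m with pc := .cycleFound }
  -- collect the first part of the cycle along the pred pointers
  | .cycleFound => { m with
      dist := Function.update m.dist m.p_f (m.dist m.cur)
      path_pref := []
      pc := .predWalk }
  | .predWalk => match m.pred m.cur with
    | some q => { m with
        path_pref := q :: m.path_pref
        cur := q
        pc := if q = m.p_f then .cycleConcat else .predWalk }
    | none => { m with pc := .cycleConcat }
  | .cycleConcat => { m with cycle := m.path_pref ++ m.path_suf, pc := .cycleDone }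
  -- back in the outer search: compare with the best cycle found so far
  | .cycleDone =>
    if m.weight_max < m.dist m.p_f then
      { m with
        weight_max := m.dist m.p_f
        cycle_max := m.cycle
        stem_max := m.stack_outer
        pc := .dfsRepeat }
    else { m with pc := .dfsRepeat }
  -- if a run was found, reverse its stem and project it to the transition system
  | .returnRun =>
    if m.cycle_max = [] then { m with pc := .traceStart } else { m with pc := .projStem }
  | .projStem => match m.stem_max with
    | p :: ps => { m with stem_out := I.proj p :: m.stem_out, stem_max := ps }
    | [] => { m with pc := .projCycle }
  | .projCycle => match m.cycle_max with
    | p :: ps => { m with cycle_out := m.cycle_out ++ [I.proj p], cycle_max := ps }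
    | [] => { m with pc := .halt }
  -- otherwise find an arbitrary trace by a depth-first search in the transition system
  | .traceStart => { m with
      tstack := [I.tstart]
      tvisited := {I.tstart}
      tonstack := {I.tstart}
      tunscanned := Function.update m.tunscanned I.tstart (I.tsucc I.tstart)
      pc := .traceScan }
  | .traceScan => match m.tstack with
    | [] => { m with pc := .halt }
    | s :: st => match m.tunscanned s with
      | [] => { m with tstack := st, tonstack := m.tonstack.erase s }
      | x :: xs =>
        if x ∈ m.tonstack then { m with tclose := x, cycle_out := [x], pc := .traceCycle }
        else if x ∈ m.tvisited then
          { m with tunscanned := Function.update m.tunscanned s xs }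
        else
          { m with
            tunscanned := Function.update (Function.update m.tunscanned s xs) x (I.tsucc x)
            tstack := x :: m.tstack
            tvisited := insert x m.tvisited
            tonstack := insert x m.tonstack }
  | .traceCycle => match m.tstack with
    | s :: st => { m with
        cycle_out := s :: m.cycle_out
        tstack := st
        pc := if s = m.tclose then .traceStem else .traceCycle }
    | [] => { m with pc := .halt }
  | .traceStem => match m.tstack with
    | s :: st => { m with stem_out := s :: m.stem_out, tstack := st }
    | [] => { m with pc := .halt }
  | .halt => m

/-- The program started on the input `I` halts after at most `t` steps. -/
def HaltsWithin (I : Input V S) (t : ℕ) : Prop :=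
  ((step I)^[t] (initial I)).pc = Line.halt

end Program

/-- The input for the product automaton of `T` and the weighted Büchi automaton of the automata
`G i` with rewards `rew i`, represented by lists of states and of successors. -/
def missionInput {AP : Type u} {n : ℕ} (T : TransitionSystem.{u, v} AP)
    (G : Fin n → GBA.{u, w} (Set AP)) (rew : Fin n → ℕ)
    (states : Listing (missionProduct T G rew).Q)
    (adj : AdjacencyLists (missionProduct T G rew).δ) (tadj : AdjacencyLists T.R)
    (threshold : ℕ) : Input (missionProduct T G rew).Q T.S where
  n := n
  states := states.list
  start := (missionProduct T G rew).start
  succ := adj.succ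
  weight := (missionProduct T G rew).W
  accepting p := p ∈ (missionProduct T G rew).F
  layer p := Component.layer (G := G) p.2.2
  proj p := p.1
  tstart := T.start
  tsucc := tadj.succ
  threshold := threshold

end WeightedNestedDFS

namespace LTL

variable {AP : Type u}

theorem mem_sub_self (φ : LTL AP) : φ ∈ φ.sub := by
  cases φ <;> simp [sub]

theorem sub_subset_of_mem {φ ψ : LTL AP} (h : ψ ∈ φ.sub) : ψ.sub ⊆ φ.sub := by
  induction φ with
  | top => simp only [sub, Set.mem_singleton_iff] at h; rw [h]
  | atom a => simp only [sub, Set.mem_singleton_iff] at h; rw [h]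
  | neg φ ih | next φ ih =>
    simp only [sub, Set.mem_insert_iff] at h
    rcases h with rfl | h
    · rfl
    · exact (ih h).trans (Set.subset_insert _ _)
  | and φ₁ φ₂ ih₁ ih₂ | untl φ₁ φ₂ ih₁ ih₂ =>
    simp only [sub, Set.mem_insert_iff, Set.mem_union] at h
    rcases h with rfl | h | h
    · rfl
    · exact ((ih₁ h).trans Set.subset_union_left).trans (Set.subset_insert _ _)
    · exact ((ih₂ h).trans Set.subset_union_right).trans (Set.subset_insert _ _)

theorem mem_untils_of_mem_sub {φ χ₁ χ₂ : LTL AP} (h : untl χ₁ χ₂ ∈ φ.sub) :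
    (χ₁, χ₂) ∈ φ.untils := by
  induction φ with
  | top => simp [sub] at h
  | atom a => simp [sub] at h
  | neg φ ih | next φ ih => simpa [untils] using ih (by simpa [sub] using h)
  | and φ₁ φ₂ ih₁ ih₂ =>
    simp only [sub, Set.mem_insert_iff, Set.mem_union, reduceCtorEq, false_or] at h
    simpa [untils] using h.imp ih₁ ih₂
  | untl φ₁ φ₂ ih₁ ih₂ =>
    simp only [sub, Set.mem_insert_iff, Set.mem_union, untl.injEq] at h
    simpa [untils] using h.imp id (Or.imp ih₁ ih₂)

theorem untl_mem_sub_of_mem_untils {φ : LTL AP} {χ : LTL AP × LTL AP} (h : χ ∈ φ.untils) :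
    untl χ.1 χ.2 ∈ φ.sub := by
  induction φ with
  | top => simp [untils] at h
  | atom a => simp [untils] at h
  | neg φ ih | next φ ih => exact Set.mem_insert_of_mem _ (ih h)
  | and φ₁ φ₂ ih₁ ih₂ =>
    simp only [untils, List.mem_append] at h
    exact Set.mem_insert_of_mem _ (h.imp ih₁ ih₂)
  | untl φ₁ φ₂ ih₁ ih₂ =>
    simp only [untils, List.mem_cons, List.mem_append] at h
    rcases h with rfl | h
    · exact mem_sub_self _
    · exact Set.mem_insert_of_mem _ (h.imp ih₁ ih₂)

/-- The one-step unfolding of the until operator. -/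
theorem sat_untl_iff (w : ℕ → Set AP) (χ₁ χ₂ : LTL AP) (i : ℕ) :
    Sat w (untl χ₁ χ₂) i ↔ Sat w χ₂ i ∨ (Sat w χ₁ i ∧ Sat w (untl χ₁ χ₂) (i + 1)) := by
  simp only [Sat]
  constructor
  · rintro ⟨k, hik, hk, h⟩
    rcases hik.eq_or_lt with rfl | hlt
    · exact Or.inl hk
    · exact Or.inr ⟨h i le_rfl hlt, k, hlt, hk, fun j hj hjk => h j (by omega) hjk⟩
  · rintro (h | ⟨h₁, k, hik, hk, h⟩)
    · exact ⟨i, le_rfl, h, fun j hj hji => absurd hji (by omega)⟩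
    · refine ⟨k, by omega, hk, fun j hj hjk => ?_⟩
      rcases hj.eq_or_lt with rfl | hlt
      · exact h₁
      · exact h j hlt hjk

/-- In a sequence of consistent sets that fulfils all until-subformulas, the claimed subformulas are
the satisfied ones. -/
theorem mem_iff_sat_of_consistent {φ : LTL AP} {x : ℕ → Set AP} {B : ℕ → Set φ.sub}
    (hB : ∀ i, φ.Consistent (B i) (x i) (B (i + 1)))
    (hacc : ∀ χ₁ χ₂ (h : untl χ₁ χ₂ ∈ φ.sub), ∀ N, ∃ i, N ≤ i ∧
      ((⟨_, h⟩ : φ.sub) ∈ B i → ∃ h₂ : χ₂ ∈ φ.sub, (⟨_, h₂⟩ : φ.sub) ∈ B i))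
    (ψ : LTL AP) (hψ : ψ ∈ φ.sub) (i : ℕ) :
    (∃ h : ψ ∈ φ.sub, (⟨ψ, h⟩ : φ.sub) ∈ B i) ↔ Sat x ψ i := by
  induction ψ generalizing i with
  | top => simpa [Sat] using hB i top hψ
  | atom a => exact hB i (atom a) hψ
  | neg χ ih =>
    have h : χ ∈ φ.sub := sub_subset_of_mem hψ (Set.mem_insert_of_mem _ (mem_sub_self _))
    exact (hB i _ hψ).trans (not_congr (ih h i))
  | and χ₁ χ₂ ih₁ ih₂ =>
    have h₁ : χ₁ ∈ φ.sub :=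
      sub_subset_of_mem hψ (Set.mem_insert_of_mem _ (Or.inl (mem_sub_self _)))
    have h₂ : χ₂ ∈ φ.sub :=
      sub_subset_of_mem hψ (Set.mem_insert_of_mem _ (Or.inr (mem_sub_self _)))
    exact (hB i _ hψ).trans (and_congr (ih₁ h₁ i) (ih₂ h₂ i))
  | next χ ih =>
    have h : χ ∈ φ.sub := sub_subset_of_mem hψ (Set.mem_insert_of_mem _ (mem_sub_self _))
    exact (hB i _ hψ).trans (ih h (i + 1))
  | untl χ₁ χ₂ ih₁ ih₂ =>
    have h₁ : χ₁ ∈ φ.sub :=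
      sub_subset_of_mem hψ (Set.mem_insert_of_mem _ (Or.inl (mem_sub_self _)))
    have h₂ : χ₂ ∈ φ.sub :=
      sub_subset_of_mem hψ (Set.mem_insert_of_mem _ (Or.inr (mem_sub_self _)))
    have unfold : ∀ j, (∃ h : untl χ₁ χ₂ ∈ φ.sub, (⟨_, h⟩ : φ.sub) ∈ B j) ↔
        Sat x χ₂ j ∨ (Sat x χ₁ j ∧ ∃ h : untl χ₁ χ₂ ∈ φ.sub, (⟨_, h⟩ : φ.sub) ∈ B (j + 1)) :=
      fun j => (hB j _ hψ).trans (or_congr (ih₂ h₂ j) (and_congr_left' (ih₁ h₁ j)))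
    constructor
    · intro h
      by_contra hns
      have hall : ∀ d, (∃ h : untl χ₁ χ₂ ∈ φ.sub, (⟨_, h⟩ : φ.sub) ∈ B (i + d)) ∧
          ¬ Sat x (untl χ₁ χ₂) (i + d) := by
        intro d
        induction d with
        | zero => exact ⟨h, hns⟩
        | succ d ihd =>
          have hu := (unfold _).1 ihd.1
          have hs := ihd.2
          rw [sat_untl_iff, not_or, not_and] at hs
          obtain ⟨hs₁, hs₂⟩ := hu.resolve_left hs.1
          exact ⟨hs₂, hs.2 hs₁⟩
      obtain ⟨k, hik, hk⟩ := hacc χ₁ χ₂ hψ i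
      obtain ⟨d, rfl⟩ := Nat.exists_eq_add_of_le hik
      obtain ⟨⟨_, hmem⟩, hs⟩ := hall d
      exact hs ((sat_untl_iff _ _ _ _).2 (Or.inl ((ih₂ h₂ _).1 (hk hmem))))
    · rintro ⟨k, hik, hk, h⟩
      obtain ⟨d, rfl⟩ := Nat.exists_eq_add_of_le hik
      clear hik
      induction d generalizing i with
      | zero => exact (unfold i).2 (Or.inl hk)
      | succ d ihd =>
        refine (unfold i).2 (Or.inr ⟨h i le_rfl (by omega), ihd (i + 1) ?_ fun j hj hjk => ?_⟩)
        · rwa [show i + 1 + d = i + (d + 1) by omega]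
        · exact h j (by omega) (by omega)

/-- The satisfied subformulas form consistent sets. -/
theorem consistent_setOf_sat (φ : LTL AP) (x : ℕ → Set AP) (i : ℕ) :
    φ.Consistent {ψ : φ.sub | Sat x ψ.1 i} (x i) {ψ : φ.sub | Sat x ψ.1 (i + 1)} := by
  intro ψ hψ
  have hh : ∀ i χ, χ ∈ φ.sub →
      ((∃ h : χ ∈ φ.sub, (⟨χ, h⟩ : φ.sub) ∈ {ψ : φ.sub | Sat x ψ.1 i}) ↔ Sat x χ i) :=
    fun i χ h => ⟨fun ⟨_, h'⟩ => h', fun h' => ⟨h, h'⟩⟩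
  refine (hh i ψ hψ).trans ?_
  have hs := sub_subset_of_mem hψ
  cases ψ with
  | top => exact Iff.rfl
  | atom a => exact Iff.rfl
  | neg χ => exact not_congr (hh i χ (hs (Set.mem_insert_of_mem _ (mem_sub_self _)))).symm
  | and χ₁ χ₂ =>
    exact and_congr (hh i χ₁ (hs (Set.mem_insert_of_mem _ (Or.inl (mem_sub_self _))))).symm
      (hh i χ₂ (hs (Set.mem_insert_of_mem _ (Or.inr (mem_sub_self _))))).symm
  | next χ => exact (hh (i + 1) χ (hs (Set.mem_insert_of_mem _ (mem_sub_self _)))).symm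
  | untl χ₁ χ₂ =>
    exact (sat_untl_iff _ _ _ _).trans (or_congr
      (hh i χ₂ (hs (Set.mem_insert_of_mem _ (Or.inr (mem_sub_self _))))).symm
      (and_congr (hh i χ₁ (hs (Set.mem_insert_of_mem _ (Or.inl (mem_sub_self _))))).symm
        (hh (i + 1) _ hψ).symm))

theorem tableau_language (φ : LTL AP) : φ.tableau.language = {x | φ.Sat x 0} := by
  ext x
  constructor
  · rintro ⟨ρ, h0, hδ, hacc⟩
    have hsome : ∀ i, ∃ B : Set φ.sub, ρ (i + 1) = some B := by
      intro i
      have h := hδ i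
      cases hq : ρ (i + 1) with
      | none => rw [hq] at h; cases hp : ρ i <;> rw [hp] at h <;> exact h.elim
      | some B => exact ⟨B, rfl⟩
    choose B hB using hsome
    have hfirst := hδ 0
    rw [h0, hB 0] at hfirst
    obtain ⟨B₀, ⟨hmem, hφ⟩, hcons⟩ := hfirst
    let B' : ℕ → Set φ.sub := fun i => Nat.casesOn i B₀ B
    have hB' : ∀ i, φ.Consistent (B' i) (x i) (B' (i + 1)) := by
      intro i
      cases i with
      | zero => exact hcons
      | succ i =>
        have h := hδ (i + 1)
        rw [hB i, hB (i + 1)] at h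
        exact h
    refine (mem_iff_sat_of_consistent hB' ?_ φ hmem 0).1 ⟨hmem, hφ⟩
    intro χ₁ χ₂ h N
    obtain ⟨k, hk⟩ := List.get_of_mem (mem_untils_of_mem_sub h)
    obtain ⟨i, hi, hia⟩ := hacc k.succ (N + 1)
    obtain ⟨i, rfl⟩ := Nat.exists_eq_add_of_le' (show 1 ≤ i by omega)
    obtain ⟨C, hC, hCa⟩ := hia
    rw [hB i] at hC
    cases hC
    rw [hk] at hCa
    exact ⟨i + 1, by omega, fun hm => hCa ⟨h, hm⟩⟩
  · intro hx
    let B : ℕ → Set φ.sub := fun i => {ψ | Sat x ψ.1 i}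
    refine ⟨fun i => Nat.casesOn i none fun i => some (B (i + 1)), rfl, fun i => ?_,
      fun k N => ?_⟩
    · cases i with
      | zero => exact ⟨B 0, ⟨mem_sub_self φ, hx⟩, consistent_setOf_sat φ x 0⟩
      | succ i => exact consistent_setOf_sat φ x (i + 1)
    · refine Fin.cases ⟨N, le_rfl, trivial⟩ (fun k => ?_) k
      have hk := untl_mem_sub_of_mem_untils (List.get_mem φ.untils k)
      have hk₂ := sub_subset_of_mem hk (Set.mem_insert_of_mem _ (Or.inr (mem_sub_self _)))
      by_cases hs : Sat x (untl (φ.untils.get k).1 (φ.untils.get k).2) (N + 1)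
      · obtain ⟨i, hi, hsi, -⟩ := hs
        obtain ⟨i, rfl⟩ := Nat.exists_eq_add_of_le' (show 1 ≤ i by omega)
        exact ⟨i + 1, by omega, B (i + 1), rfl, fun _ => ⟨hk₂, hsi⟩⟩
      · exact ⟨N + 1, by omega, B (N + 1), rfl, fun ⟨_, h⟩ => (hs h).elim⟩

end LTL

namespace GBA

variable {A : Type u}

theorem complete_nonBlocking (G : GBA.{u, w} A) : G.complete.NonBlocking := by
  intro q σ
  cases q with
  | none => exact ⟨none, trivial⟩
  | some q =>
    by_cases h : ∃ q', G.δ q σ q'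
    · exact ⟨some h.choose, h.choose_spec⟩
    · exact ⟨none, h⟩

theorem complete_language (G : GBA.{u, w} A) (hm : 0 < G.m) : G.complete.language = G.language := by
  ext x
  constructor
  · rintro ⟨ρ, h0, hδ, hacc⟩
    have hsink : ∀ i, ρ i = none → ∀ d, ρ (i + d) = none := by
      intro i hi d
      induction d with
      | zero => exact hi
      | succ d ih =>
        have h := hδ (i + d)
        rw [ih] at h
        cases hq : ρ (i + d + 1) with
        | none => rfl
        | some q => rw [hq] at h; exact h.elim
    have hsome : ∀ i, ∃ q, some q = ρ i := by
      intro i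
      cases hq : ρ i with
      | some q => exact ⟨q, rfl⟩
      | none =>
        obtain ⟨j, hj, q, -, hjq⟩ := hacc (⟨0, hm⟩ : Fin G.m) i
        obtain ⟨d, rfl⟩ := Nat.exists_eq_add_of_le hj
        rw [hsink i hq d] at hjq
        cases hjq
    choose r hr using hsome
    refine ⟨r, Option.some_injective _ ((hr 0).trans h0), fun i => ?_, fun k N => ?_⟩
    · have h := hδ i
      rw [← hr i, ← hr (i + 1)] at h
      exact h
    · obtain ⟨i, hi, q, hq, hqi⟩ := hacc k N
      rw [← hr i] at hqi
      cases hqi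
      exact ⟨i, hi, hq⟩
  · rintro ⟨ρ, h0, hδ, hacc⟩
    refine ⟨fun i => some (ρ i), congrArg some h0, hδ, fun k N => ?_⟩
    obtain ⟨i, hi, h⟩ := hacc k N
    exact ⟨i, hi, ρ i, h, rfl⟩

end GBA

theorem LTL.toGBA_language {AP : Type u} (φ : LTL AP) : φ.toGBA.language = {x | φ.Sat x 0} :=
  (φ.tableau.complete_language (Nat.succ_pos _)).trans φ.tableau_language

namespace LTL

variable {AP : Type u}

theorem ncard_sub_le (φ : LTL AP) : φ.sub.ncard ≤ 2 * φ.size + 1 := by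
  induction φ with
  | top => simp [sub]
  | atom a => simp [sub]
  | neg φ ih | next φ ih =>
    have := Set.ncard_insert_le (neg φ) φ.sub
    have := Set.ncard_insert_le (next φ) φ.sub
    simp only [sub, size]
    omega
  | and φ ψ ih₁ ih₂ | untl φ ψ ih₁ ih₂ =>
    have := Set.ncard_insert_le (and φ ψ) (φ.sub ∪ ψ.sub)
    have := Set.ncard_insert_le (untl φ ψ) (φ.sub ∪ ψ.sub)
    have := Set.ncard_union_le φ.sub ψ.sub
    simp only [sub, size]
    omega

theorem length_untils_le (φ : LTL AP) : φ.untils.length ≤ φ.size := by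
  induction φ with
  | top => simp [untils]
  | atom a => simp [untils]
  | neg φ ih | next φ ih => simp only [untils, size]; omega
  | and φ ψ ih₁ ih₂ | untl φ ψ ih₁ ih₂ =>
    simp only [untils, size, List.length_append, List.length_cons]
    omega

theorem card_toGBA_le (φ : LTL AP) : Nat.card φ.toGBA.Q ≤ 2 ^ (2 * φ.size + 1) + 2 := by
  have hfin : Finite φ.sub := φ.finite_sub
  have h : Nat.card φ.toGBA.Q = 2 ^ φ.sub.ncard + 2 := by
    change Nat.card (Option (Option (Set φ.sub))) = _
    rw [Finite.card_option, Finite.card_option]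
    rw [add_assoc]
    congr 1
    have := Fintype.ofFinite φ.sub
    rw [Nat.card_eq_fintype_card, Fintype.card_set, ← Nat.card_eq_fintype_card]
    rfl
  rw [h]
  exact Nat.add_le_add_right (Nat.pow_le_pow_right (by norm_num) φ.ncard_sub_le) _

end LTL

theorem card_weightedBuchi {A : Type u} {n : ℕ} (G : Fin n → GBA.{u, w} A) (rew : Fin n → ℕ) :
    Nat.card (weightedBuchi G rew).Q = (∏ i, Nat.card (G i).Q) * (1 + ∑ i, (G i).m) := by
  have := fun i => (G i).finite
  change Nat.card ((∀ i, (G i).Q) × Option (Σ j : Fin n, Fin (G j).m)) = _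
  rw [Nat.card_prod, Nat.card_pi, Finite.card_option, Nat.card_sigma]
  simp [add_comm]

theorem size_product_le {AP : Type u} (T : TransitionSystem.{u, v} AP)
    (B : WeightedBuchi.{u, w} (Set AP)) :
    (product T B).size ≤ T.size * Nat.card B.Q ^ 2 := by
  have := T.finite
  have := B.finite
  have hpos : 0 < Nat.card B.Q := by
    have : Nonempty B.Q := ⟨B.start⟩
    exact Nat.card_pos
  have hQ : Nat.card (product T B).Q = Nat.card T.S * Nat.card B.Q := Nat.card_prod _ _
  have hE : Nat.card {e : (product T B).Q × (product T B).Q // (product T B).δ e.1 e.2} ≤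
      Nat.card {e : T.S × T.S // T.R e.1 e.2} * Nat.card B.Q ^ 2 := by
    have h := Nat.card_le_card_of_injective
      (fun e : {e : (product T B).Q × (product T B).Q // (product T B).δ e.1 e.2} =>
        ((⟨(e.1.1.1, e.1.2.1), e.2.1⟩, (e.1.1.2, e.1.2.2)) :
          {e : T.S × T.S // T.R e.1 e.2} × (B.Q × B.Q)))
      (by
        rintro ⟨⟨⟨a, b⟩, c, d⟩, h⟩ ⟨⟨⟨a', b'⟩, c', d'⟩, h'⟩ heq
        simp only [Prod.mk.injEq, Subtype.mk.injEq] at heq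
        obtain ⟨⟨rfl, rfl⟩, rfl, rfl⟩ := heq
        rfl)
    rwa [Nat.card_prod, Nat.card_prod, ← sq] at h
  have hsq : Nat.card B.Q ≤ Nat.card B.Q ^ 2 := Nat.le_self_pow two_ne_zero _
  rw [WeightedProduct.size, TransitionSystem.size, hQ, add_mul]
  exact add_le_add (Nat.mul_le_mul_left _ hsq) hE

theorem size_missionProduct_toGBA_le {AP : Type u} {n : ℕ} (T : TransitionSystem.{u, v} AP)
    (Φ : Fin n → LTL AP) (rew : Fin n → ℕ) :
    (missionProduct T (fun i => (Φ i).toGBA) rew).size ≤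
      14 * T.size * 2 ^ (14 * (∑ i, (Φ i).size +
        (Finset.univ.filter fun i => (Φ i).size = 0).card)) := by
  let s : Fin n → ℕ := fun i => (Φ i).size + if (Φ i).size = 0 then 1 else 0
  have hs1 : ∀ i, 1 ≤ s i := by intro i; simp only [s]; split_ifs <;> omega
  have hs2 : ∀ i, (Φ i).size ≤ s i := fun i => Nat.le_add_right _ _
  have hsum : ∑ i, (Φ i).size + (Finset.univ.filter fun i => (Φ i).size = 0).card = ∑ i, s i := by
    rw [Finset.sum_add_distrib, Finset.card_filter]
  rw [hsum]
  have hQ : ∏ i, Nat.card (Φ i).toGBA.Q ≤ 2 ^ (5 * ∑ i, s i) := by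
    rw [Finset.mul_sum, ← Finset.prod_pow_eq_pow_sum]
    refine Finset.prod_le_prod' fun i _ => (Φ i).card_toGBA_le.trans ?_
    calc 2 ^ (2 * (Φ i).size + 1) + 2 ≤ 2 ^ (2 * s i + 1) + 2 ^ (2 * s i + 1) := by
          have := hs1 i
          have := hs2 i
          exact add_le_add (Nat.pow_le_pow_right (by norm_num) (by omega))
            (Nat.le_self_pow (by omega) 2)
      _ = 2 ^ (2 * s i + 2) := by ring
      _ ≤ 2 ^ (5 * s i) := Nat.pow_le_pow_right (by norm_num) (by have := hs1 i; omega)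
  have hm : 1 + ∑ i, (Φ i).toGBA.m ≤ 2 ^ (2 * ∑ i, s i) := by
    have h : ∑ i, (Φ i).toGBA.m ≤ 2 * ∑ i, s i := by
      rw [Finset.mul_sum]
      refine Finset.sum_le_sum fun i _ => ?_
      have h1 : (Φ i).toGBA.m = (Φ i).untils.length + 1 := rfl
      have := (Φ i).length_untils_le
      have := hs1 i
      have := hs2 i
      omega
    have := Nat.lt_two_pow_self (n := 2 * ∑ i, s i)
    omega
  have hB : Nat.card (weightedBuchi (fun i => (Φ i).toGBA) rew).Q ≤ 2 ^ (7 * ∑ i, s i) := by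
    rw [card_weightedBuchi]
    refine (Nat.mul_le_mul hQ hm).trans_eq ?_
    rw [← pow_add]
    ring_nf
  calc _ ≤ T.size * (2 ^ (7 * ∑ i, s i)) ^ 2 :=
        (size_product_le T _).trans (Nat.mul_le_mul_left _ (Nat.pow_le_pow_left hB 2))
    _ = T.size * 2 ^ (14 * ∑ i, s i) := by rw [← pow_mul]; ring_nf
    _ ≤ _ := Nat.mul_le_mul_right _ (Nat.le_mul_of_pos_left _ (by norm_num))

namespace WeightedNestedDFS

/-- The number of steps from the memory `m` to the end of the program is at most `k`. -/
def HaltsFrom {V : Type w} {S : Type v} (I : Input V S) (m : Mem V S) (k : ℕ) : Prop :=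
  ((step I)^[k] m).pc = Line.halt

section Halting

variable {V : Type w} {S : Type v} {I : Input V S} {m : Mem V S} {k k' : ℕ}

theorem HaltsFrom.succ (h : HaltsFrom I (step I m) k) : HaltsFrom I m (k + 1) := h

theorem haltsFrom_of_pc_eq_halt (h : m.pc = .halt) : HaltsFrom I m k := by
  have hs : step I m = m := by simp [step, h]
  rw [HaltsFrom, Function.iterate_fixed hs, h]

theorem HaltsFrom.mono (h : HaltsFrom I m k) (hk : k ≤ k') : HaltsFrom I m k' := by
  obtain ⟨d, rfl⟩ := Nat.exists_eq_add_of_le' hk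
  rw [HaltsFrom, Function.iterate_add_apply]
  exact haltsFrom_of_pc_eq_halt h

theorem HaltsFrom.of_step (h : HaltsFrom I (step I m) k) (hk : k < k') : HaltsFrom I m k' :=
  h.succ.mono hk

end Halting

/-! ### Potentials of depth-first searches -/

section Potential

open scoped Classical

variable {V : Type w} [Fintype V]

/-- The total of `f` over the states that have not been visited. -/
noncomputable def unvisitedSum (f : V → ℕ) (s : Finset V) : ℕ := ∑ p ∈ sᶜ, f p

theorem unvisitedSum_insert (f : V → ℕ) {s : Finset V} {x : V} (hx : x ∉ s) :
    unvisitedSum f (insert x s) + f x = unvisitedSum f s := by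
  rw [unvisitedSum, unvisitedSum, Finset.compl_insert,
    Finset.sum_erase_add _ _ (Finset.mem_compl.2 hx)]

theorem unvisitedSum_le (f : V → ℕ) (s : Finset V) : unvisitedSum f s ≤ ∑ p, f p :=
  Finset.sum_le_sum_of_subset (Finset.subset_univ _)


end Potential

section Stack

variable {V : Type w}

/-- The total over a stack of `c p`, and of `e` for every successor of `p` that is not scanned. -/
def stackSum (c : V → ℕ) (e : ℕ) (u : V → List V) (st : List V) : ℕ :=
  (st.map fun p => e * (u p).length + c p).sum

theorem stackSum_nil (c : V → ℕ) (e : ℕ) (u : V → List V) : stackSum c e u [] = 0 := rfl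

theorem stackSum_cons (c : V → ℕ) (e : ℕ) (u : V → List V) (p : V) (st : List V) :
    stackSum c e u (p :: st) = e * (u p).length + c p + stackSum c e u st := rfl

theorem stackSum_update [DecidableEq V] (c : V → ℕ) (e : ℕ) (u : V → List V) {x : V} {st : List V}
    (hx : x ∉ st) (l : List V) : stackSum c e (Function.update u x l) st = stackSum c e u st := by
  unfold stackSum
  congr 1
  refine List.map_congr_left fun p hp => ?_
  rw [Function.update_of_ne (by rintro rfl; exact hx hp)]

/-- Scanning one successor of the top of the stack. -/
theorem stackSum_scan [DecidableEq V] (c : V → ℕ) (e : ℕ) {u : V → List V} {p x : V}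
    {st xs : List V} (hp : (p :: st).Nodup) (hu : u p = x :: xs) :
    stackSum c e (Function.update u p xs) (p :: st) + e = stackSum c e u (p :: st) := by
  rw [stackSum_cons, stackSum_cons, stackSum_update _ _ _ (List.nodup_cons.1 hp).1, hu]
  simp only [Function.update_self, List.length_cons]
  ring

/-- Scanning one successor of the top of the stack and pushing it. -/
theorem stackSum_push [DecidableEq V] (c : V → ℕ) (e : ℕ) {u : V → List V} {p x : V}
    {st xs : List V} (hp : (p :: st).Nodup) (hx : x ∉ p :: st) (hu : u p = x :: xs) (l : List V) :
    stackSum c e (Function.update (Function.update u p xs) x l) (x :: p :: st) + e =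
      stackSum c e u (p :: st) + (e * l.length + c x) := by
  rw [stackSum_cons, stackSum_update _ _ _ hx, ← stackSum_scan c e hp hu]
  simp only [Function.update_self]
  ring

end Stack

/-! ### The tail of the program: projection of the run, or an arbitrary trace -/

section Tail

open scoped Classical

variable {V : Type w} {S : Type v} {I : Input V S}

theorem haltsFrom_projCycle (l : List V) (m : Mem V S) (hpc : m.pc = .projCycle)
    (hl : m.cycle_max = l) : HaltsFrom I m (l.length + 1) := by
  induction l generalizing m with
  | nil => exact HaltsFrom.succ (haltsFrom_of_pc_eq_halt (by simp [step, hpc, hl]))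
  | cons p l ih => exact HaltsFrom.succ (ih _ (by simp [step, hpc, hl]) (by simp [step, hpc, hl]))

theorem haltsFrom_projStem (l : List V) (m : Mem V S) (hpc : m.pc = .projStem)
    (hl : m.stem_max = l) : HaltsFrom I m (l.length + 1 + (m.cycle_max.length + 1)) := by
  induction l generalizing m with
  | nil =>
    have h : HaltsFrom I (step I m) (m.cycle_max.length + 1) :=
      haltsFrom_projCycle _ _ (by simp [step, hpc, hl]) (by simp [step, hpc, hl])
    exact h.of_step (by simp)
  | cons p l ih =>
    have h := ih (step I m) (by simp [step, hpc, hl]) (by simp [step, hpc, hl])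
    refine h.of_step ?_
    simp only [step, hpc, hl, List.length_cons]
    omega

theorem haltsFrom_traceStem (l : List S) (m : Mem V S) (hpc : m.pc = .traceStem)
    (hl : m.tstack = l) : HaltsFrom I m (l.length + 1) := by
  induction l generalizing m with
  | nil => exact HaltsFrom.succ (haltsFrom_of_pc_eq_halt (by simp [step, hpc, hl]))
  | cons s l ih => exact HaltsFrom.succ (ih _ (by simp [step, hpc, hl]) (by simp [step, hpc, hl]))

theorem haltsFrom_traceCycle (l : List S) (m : Mem V S) (hpc : m.pc = .traceCycle)
    (hl : m.tstack = l) : HaltsFrom I m (l.length + 1) := by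
  induction l generalizing m with
  | nil => exact HaltsFrom.succ (haltsFrom_of_pc_eq_halt (by simp [step, hpc, hl]))
  | cons s l ih =>
    by_cases hs : s = m.tclose
    · exact HaltsFrom.succ (haltsFrom_traceStem l _ (by simp [step, hpc, hl, hs])
        (by simp [step, hpc, hl]))
    · exact HaltsFrom.succ (ih _ (by simp [step, hpc, hl, hs]) (by simp [step, hpc, hl]))

theorem length_le_stackSum (u : S → List S) (st : List S) :
    st.length ≤ stackSum (fun _ => 1) 1 u st := by
  induction st with
  | nil => simp
  | cons s st ih => rw [stackSum_cons, List.length_cons]; omega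

variable [Fintype S]

theorem haltsFrom_traceScan (k : ℕ) (m : Mem V S) (hpc : m.pc = .traceScan)
    (hnd : m.tstack.Nodup) (hsub : ∀ s ∈ m.tstack, s ∈ m.tvisited)
    (hk : unvisitedSum (fun s => (I.tsucc s).length + 1) m.tvisited +
      stackSum (fun _ => 1) 1 m.tunscanned m.tstack + 2 ≤ k) : HaltsFrom I m k := by
  induction k generalizing m with
  | zero => omega
  | succ k ih =>
    apply HaltsFrom.succ
    cases hst : m.tstack with
    | nil => exact haltsFrom_of_pc_eq_halt (by simp [step, hpc, hst])
    | cons s st =>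
      rw [hst] at hnd hsub hk
      cases hu : m.tunscanned s with
      | nil =>
        rw [stackSum_cons, hu] at hk
        apply ih
        · simp [step, hpc, hst, hu]
        · simpa [step, hpc, hst, hu] using hnd.of_cons
        · simpa [step, hpc, hst, hu] using fun t ht => hsub t (List.mem_cons_of_mem _ ht)
        · simp only [step, hpc, hst, hu]
          omega
      | cons x xs =>
        by_cases hx : x ∈ m.tonstack
        · have hle := length_le_stackSum m.tunscanned (s :: st)
          refine (haltsFrom_traceCycle (s :: st) (step I m) ?_ ?_).mono (by omega) <;>
            simp [step, hpc, hst, hu, hx]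
        · by_cases hx' : x ∈ m.tvisited
          · have h := stackSum_scan (fun _ => 1) 1 hnd hu
            apply ih
            · simp [step, hpc, hst, hu, hx, hx']
            · simpa [step, hpc, hst, hu, hx, hx'] using hnd
            · simpa [step, hpc, hst, hu, hx, hx'] using hsub
            · simp only [step, hpc, hst, hu, hx, hx', if_true, if_false]
              omega
          · have hxs : x ∉ s :: st := fun h => hx' (hsub x h)
            have h := stackSum_push (fun _ => 1) 1 hnd hxs hu (I.tsucc x)
            have h' := unvisitedSum_insert (fun s => (I.tsucc s).length + 1) hx'
            apply ih
            · simp [step, hpc, hst, hu, hx, hx']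
            · simpa only [step, hpc, hst, hu, hx, hx', if_false] using List.nodup_cons.2 ⟨hxs, hnd⟩
            · simp only [step, hpc, hst, hu, hx, hx', if_false]
              intro t ht
              rcases List.mem_cons.1 ht with rfl | ht
              · exact Finset.mem_insert_self _ _
              · exact Finset.mem_insert_of_mem (hsub t ht)
            · simp only [step, hpc, hst, hu, hx, hx', if_false]
              omega

theorem haltsFrom_traceStart (m : Mem V S) (hpc : m.pc = .traceStart) :
    HaltsFrom I m (∑ s, ((I.tsucc s).length + 1) + 3) := by
  refine HaltsFrom.succ (haltsFrom_traceScan _ _ (by simp [step, hpc]) (by simp [step, hpc])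
    (by simp [step, hpc]) ?_)
  have h := unvisitedSum_insert (fun s => (I.tsucc s).length + 1) (Finset.notMem_empty I.tstart)
  have h' := unvisitedSum_le (fun s => (I.tsucc s).length + 1) ∅
  have h2 : ({I.tstart} : Finset S) = insert I.tstart ∅ := rfl
  simp only [step, hpc, stackSum_cons, stackSum_nil, Function.update_self, h2]
  omega

/-- An upper bound for the running time after the outer search. -/
def tailTime [Fintype V] (I : Input V S) : ℕ :=
  3 * Fintype.card V + ∑ s, ((I.tsucc s).length + 1) + 6

theorem haltsFrom_returnRun [Fintype V] (m : Mem V S) (hpc : m.pc = .returnRun)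
    (hs : m.stem_max.length ≤ Fintype.card V) (hc : m.cycle_max.length ≤ 2 * Fintype.card V + 3) :
    HaltsFrom I m (tailTime I) := by
  unfold tailTime
  by_cases h : m.cycle_max = []
  · exact (haltsFrom_traceStart (step I m) (by simp [step, hpc, h])).of_step (by omega)
  · refine (haltsFrom_projStem m.stem_max (step I m) ?_ ?_).of_step ?_
    · simp [step, hpc, h]
    · simp [step, hpc, h]
    · simp only [step, hpc, h, if_false]
      omega

end Tail

end WeightedNestedDFS

namespace WeightedNestedDFS

section Search

open scoped Classical

variable {V : Type w} {S : Type v}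

/-- The properties of layers and weights of a mission product that bound the walk along the
pointers `pred`. -/
structure Input.Layered (I : Input V S) : Prop where
  layer_accepting : ∀ p, I.accepting p → I.layer p = 0
  weight_eq_zero : ∀ p x, x ∈ I.succ p → I.layer x = 0 ∨ I.layer x = I.layer p → I.weight p x = 0
  layer_le : ∀ p x, x ∈ I.succ p → 1 ≤ I.layer x → I.layer p ≤ I.layer x

/-! ### The walk along the predecessor pointers -/

/-- The walk along `pred` from a state ends, at `pf` or at a state without predecessor, within the
given number of steps. -/
def WalkEnds (pred : V → Option V) (pf : V) : ℕ → V → Prop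
  | 0, _ => False
  | b + 1, c => ∀ q, pred c = some q → q = pf ∨ WalkEnds pred pf b q

/-- The order in which the pointers `pred` descend: by layer, then by decreasing distance, then by
the rank `τ`. -/
def Before (I : Input V S) (dist τ : V → ℕ) (z x : V) : Prop :=
  I.layer z < I.layer x ∨
    I.layer z = I.layer x ∧ (dist x < dist z ∨ dist x = dist z ∧ τ z < τ x)

theorem Before.trans {I : Input V S} {dist τ : V → ℕ} {x y z : V}
    (h : Before I dist τ x y) (h' : Before I dist τ y z) : Before I dist τ x z := by
  unfold Before at *
  omega

theorem Before.irrefl {I : Input V S} {dist τ : V → ℕ} {x : V} : ¬ Before I dist τ x x := by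
  unfold Before
  omega

/-- The pointers `pred` of the states `U` updated in the search from `pf` lead through the states
`A` processed in this search. -/
structure PredInv (I : Input V S) (pf : V) (dist : V → ℕ) (pred : V → Option V) (τ : V → ℕ)
    (A U : Finset V) : Prop where
  processed : ∀ z ∈ A, z ≠ pf → z ∈ U ∧ 1 ≤ I.layer z
  pred : ∀ x ∈ U, ∃ z ∈ A, pred x = some z ∧ (z ≠ pf → 1 ≤ I.layer x → Before I dist τ z x)

theorem PredInv.walkEnds {I : Input V S} {pf : V} {dist : V → ℕ} {pred : V → Option V} {τ : V → ℕ}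
    {A U : Finset V} (h : PredInv I pf dist pred τ A U) {x : V} (hx : x ∈ U) :
    WalkEnds pred pf (A.card + 2) x := by
  have key : ∀ b, ∀ y ∈ U, 1 ≤ I.layer y → (A.filter fun z => Before I dist τ z y).card ≤ b →
      WalkEnds pred pf (b + 1) y := by
    intro b
    induction b with
    | zero =>
      intro y hy hl hb q hq
      obtain ⟨z, hz, hyz, hzb⟩ := h.pred y hy
      obtain rfl : z = q := Option.some_injective _ (hyz.symm.trans hq)
      by_contra! hne
      have : (A.filter fun z => Before I dist τ z y).Nonempty :=
        ⟨z, Finset.mem_filter.2 ⟨hz, hzb hne.1 hl⟩⟩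
      have := Finset.card_pos.2 this
      omega
    | succ b ih =>
      intro y hy hl hb q hq
      obtain ⟨z, hz, hyz, hzb⟩ := h.pred y hy
      obtain rfl : z = q := Option.some_injective _ (hyz.symm.trans hq)
      by_cases hne : z = pf
      · exact Or.inl hne
      · obtain ⟨hzU, hzl⟩ := h.processed z hz hne
        have hzy := hzb hne hl
        refine Or.inr (ih z hzU hzl (Nat.lt_succ_iff.1 (lt_of_lt_of_le ?_ hb)))
        refine Finset.card_lt_card (Finset.ssubset_iff_of_subset ?_ |>.2 ?_)
        · exact fun t ht => Finset.mem_filter.2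
            ⟨(Finset.mem_filter.1 ht).1, (Finset.mem_filter.1 ht).2.trans hzy⟩
        · exact ⟨z, Finset.mem_filter.2 ⟨hz, hzy⟩, fun ht => (Finset.mem_filter.1 ht).2.irrefl⟩
  intro q hq
  obtain ⟨z, hz, hxz, -⟩ := h.pred x hx
  obtain rfl : z = q := Option.some_injective _ (hxz.symm.trans hq)
  by_cases hne : z = pf
  · exact Or.inl hne
  · obtain ⟨hzU, hzl⟩ := h.processed z hz hne
    exact Or.inr (key _ z hzU hzl (Finset.card_filter_le _ _))

theorem PredInv.start (I : Input V S) (pf : V) (dist : V → ℕ) (pred : V → Option V) (τ : V → ℕ) :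
    PredInv I pf dist pred τ ∅ ∅ :=
  ⟨fun z hz => absurd hz (Finset.notMem_empty z), fun x hx => absurd hx (Finset.notMem_empty x)⟩

theorem PredInv.process {I : Input V S} {pf : V} {dist : V → ℕ} {pred : V → Option V} {τ : V → ℕ}
    {A U : Finset V} (h : PredInv I pf dist pred τ A U) {p : V}
    (hp : p ≠ pf → p ∈ U ∧ 1 ≤ I.layer p) : PredInv I pf dist pred τ (insert p A) U where
  processed z hz hne := by
    rcases Finset.mem_insert.1 hz with rfl | hz
    · exact hp hne
    · exact h.processed z hz hne
  pred x hx := by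
    obtain ⟨z, hz, h'⟩ := h.pred x hx
    exact ⟨z, Finset.mem_insert_of_mem hz, h'⟩

/-- An update of the distance of `x` by a processed state `c`. -/
theorem PredInv.update {I : Input V S} (hI : I.Layered) {pf : V} {dist : V → ℕ}
    {pred : V → Option V} {τ : V → ℕ} {A U : Finset V} (h : PredInv I pf dist pred τ A U)
    {c x : V} (hc : c ∈ A) (hx : x ∈ I.succ c) (hd : dist x < dist c + I.weight c x) :
    PredInv I pf (Function.update dist x (dist c + I.weight c x))
      (Function.update pred x (some c)) (Function.update τ x (τ c + 1)) A (insert x U) where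
  processed z hz hne := ⟨Finset.mem_insert_of_mem (h.processed z hz hne).1, (h.processed z hz hne).2⟩
  pred y hy := by
    by_cases hyx : y = x
    · subst hyx
      refine ⟨c, hc, Function.update_self .., fun hne hl => ?_⟩
      rcases (hI.layer_le c y hx hl).lt_or_eq with hlt | heq
      · exact Or.inl hlt
      · have hw := hI.weight_eq_zero c y hx (Or.inr heq.symm)
        have hcy : c ≠ y := by
          rintro rfl
          omega
        refine Or.inr ⟨heq, Or.inr ?_⟩
        rw [Function.update_self, Function.update_self, Function.update_of_ne hcy,
          Function.update_of_ne hcy]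
        omega
    · obtain ⟨z, hz, hyz, hb⟩ := h.pred y (Finset.mem_of_mem_insert_of_ne hy hyx)
      refine ⟨z, hz, by rwa [Function.update_of_ne hyx], fun hne hl => ?_⟩
      have hb := hb hne hl
      unfold Before at hb ⊢
      rw [Function.update_of_ne hyx, Function.update_of_ne hyx]
      by_cases hzx : z = x
      · subst hzx
        rw [Function.update_self, Function.update_self]
        omega
      · rwa [Function.update_of_ne hzx, Function.update_of_ne hzx]

/-! ### Potentials and invariants of the search -/

/-- The total length of the queues of the layers `idx + 1, …, n`. -/
def laterSize (n idx : ℕ) (q : ℕ → List V) : ℕ := ∑ j ∈ Finset.Ioc idx n, (q j).length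

theorem laterSize_append_le (n idx : ℕ) (q : ℕ → List V) (j : ℕ) (x : V) :
    laterSize n idx (Function.update q j (q j ++ [x])) ≤ laterSize n idx q + 1 := by
  have h : ∀ i, (Function.update q j (q j ++ [x]) i).length =
      (q i).length + if j = i then 1 else 0 := by
    intro i
    by_cases hi : i = j
    · subst hi; simp
    · rw [Function.update_of_ne hi, if_neg (Ne.symm hi), add_zero]
  simp only [laterSize, h, Finset.sum_add_distrib, Finset.sum_ite_eq]
  split_ifs <;> omega

theorem laterSize_eq_add {n idx : ℕ} (h : idx < n) (q : ℕ → List V) :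
    laterSize n idx q = (q (idx + 1)).length + laterSize n (idx + 1) q := by
  rw [laterSize, ← Finset.insert_Ioc_add_one_left_eq_Ioc h, Finset.sum_insert (by simp)]
  rfl

theorem laterSize_eq_zero {n idx : ℕ} {q : ℕ → List V} (h : ∀ j, idx < j → j ≤ n → q j = []) :
    laterSize n idx q = 0 :=
  Finset.sum_eq_zero fun j hj => by
    rw [h j (Finset.mem_Ioc.1 hj).1 (Finset.mem_Ioc.1 hj).2, List.length_nil]

/-- The total length of a list of lists. -/
def flatLength (l : List (List V)) : ℕ := (l.map List.length).sum

theorem flatLength_nil : flatLength ([] : List (List V)) = 0 := rfl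

theorem flatLength_cons (r : List V) (l : List (List V)) :
    flatLength (r :: l) = r.length + flatLength l := rfl

/-- The time charged for a state in `search_from`, if there are at most `N` of them. -/
def sortCharge (N : ℕ) : ℕ := 5 * Nat.clog 2 N + 8

/-- The time for a state of the outer search, apart from scanning its successors. -/
noncomputable def outerCost (I : Input V S) (p : V) : ℕ :=
  2 + if I.accepting p then 3 * I.n + 20 else 0

/-- The time for processing a state in the propagation. -/
def innerCost (I : Input V S) (N : ℕ) (p : V) : ℕ := (3 + sortCharge N) * (I.succ p).length + 2

variable [Fintype V] [Fintype S]

/-- The potential of the states that have not been visited in each of the three searches, and of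
the outer stack, and the time for the tail of the program. -/
noncomputable def basePot (I : Input V S) (N : ℕ) (m : Mem V S) : ℕ :=
  unvisitedSum (fun p => 2 * (I.succ p).length + outerCost I p) m.visited_outer +
    stackSum (outerCost I) 2 m.unscanned m.stack_outer +
    unvisitedSum (innerCost I N) m.visited_inner +
    unvisitedSum (fun p => (I.succ p).length + 1) m.visited_ps + tailTime I

structure OuterInv (m : Mem V S) : Prop where
  nodup : m.stack_outer.Nodup
  sub : ∀ p ∈ m.stack_outer, p ∈ m.visited_outer
  stem_le : m.stem_max.length ≤ Fintype.card V
  cycle_le : m.cycle_max.length ≤ 2 * Fintype.card V + 3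

/-- A state from which the propagation in layer `idx` may proceed. -/
def Source (I : Input V S) (pf : V) (U : Finset V) (idx : ℕ) (x : V) : Prop :=
  I.layer x = idx ∧ (idx = 0 ∧ x = pf ∨ 1 ≤ idx ∧ x ∈ U)

structure PropInv (I : Input V S) (m : Mem V S) (τ : V → ℕ) (A U : Finset V) : Prop where
  predInv : PredInv I m.p_f m.dist m.pred τ A U
  dist_pf : m.idx = 0 → m.dist m.p_f = 0
  layer_pf : I.layer m.p_f = 0
  curr : ∀ x ∈ m.queue_curr, Source I m.p_f U m.idx x
  later : ∀ j, m.idx < j → j ≤ I.n → ∀ x ∈ m.queues_all j, I.layer x = j ∧ x ∈ U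
  search_from : ∀ x ∈ m.search_from, x ∈ U

/-- The potential of the propagation. -/
noncomputable def propPot (I : Input V S) (N : ℕ) (m : Mem V S) (A : Finset V) : ℕ :=
  basePot I N m + A.card + sortCharge N * m.search_from.length +
    2 * m.queue_curr.length + 2 * laterSize I.n m.idx m.queues_all + 2 * (I.n - m.idx)

/-- The number of states in `search_from` and of successors that can still be put there. -/
noncomputable def candidates (I : Input V S) (m : Mem V S) : ℕ :=
  m.search_from.length + unvisitedSum (fun p => (I.succ p).length) m.visited_inner

/-- The invariants and the potentials at the control points of the search. -/
inductive Bound (I : Input V S) (N : ℕ) : Mem V S → ℕ → Prop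
  | halts {m k} (h : HaltsFrom I m k) : Bound I N m k
  | dfsScan {m k} (hpc : m.pc = .dfsScan) (ho : OuterInv m) (hk : basePot I N m + 1 ≤ k) :
      Bound I N m k
  | dfsRepeat {m k} (hpc : m.pc = .dfsRepeat) (ho : OuterInv m) (hk : basePot I N m + 2 ≤ k) :
      Bound I N m k
  | cycleStart {m k} (hpc : m.pc = .cycleStart) (ho : OuterInv m) (hl : I.layer m.p_f = 0)
      (hd : m.dist m.p_f = 0) (hk : basePot I N m + 3 * I.n + 20 ≤ k) : Bound I N m k
  | clearQueues {m k} (hpc : m.pc = .clearQueues) (ho : OuterInv m) (hl : I.layer m.p_f = 0)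
      (hd : m.dist m.p_f = 0) (hq : m.queue_curr = [m.p_f])
      (hi : 1 ≤ m.idx) (he : ∀ j, 1 ≤ j → j < m.idx → m.queues_all j = [])
      (hk : basePot I N m + (I.n + 1 - m.idx) + 2 * I.n + 18 ≤ k) : Bound I N m k
  | propPop {m k} (τ A U) (hpc : m.pc = .propPop) (ho : OuterInv m) (hp : PropInv I m τ A U)
      (hc : candidates I m ≤ N) (hk : propPot I N m A + 14 ≤ k) : Bound I N m k
  | propSucc {m k} (τ A U) (hpc : m.pc = .propSucc) (ho : OuterInv m) (hp : PropInv I m τ A U)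
      (hcA : m.cur ∈ A) (hs : Source I m.p_f U m.idx m.cur) (hsucc : ∀ x ∈ m.succs, x ∈ I.succ m.cur)
      (hc : candidates I m + m.succs.length ≤ N)
      (hk : propPot I N m A + (3 + sortCharge N) * m.succs.length + 16 ≤ k) : Bound I N m k
  | propRepeat {m k} (τ A U) (hpc : m.pc = .propRepeat) (ho : OuterInv m) (hp : PropInv I m τ A U)
      (hc : candidates I m ≤ N) (hk : propPot I N m A + 15 ≤ k) : Bound I N m k
  | nextLayer {m k} (τ A U) (hpc : m.pc = .nextLayer) (ho : OuterInv m) (hp : PropInv I m τ A U)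
      (hc : candidates I m ≤ N) (hk : propPot I N m A + 13 ≤ k) : Bound I N m k
  | sortSplit {m k} (a : ℕ) (U : Finset V) (hpc : m.pc = .sortSplit) (ho : OuterInv m)
      (ha : a ≤ Fintype.card V) (hw : ∀ x ∈ U, WalkEnds m.pred m.p_f (a + 2) x)
      (hs : ∀ x ∈ m.search_from, x ∈ U) (hr : ∀ r ∈ m.runs, ∀ x ∈ r, x ∈ U)
      (hf : flatLength m.runs = m.runs.length) (hm : m.merged = [])
      (hN : m.search_from.length + m.runs.length ≤ N)
      (hk : basePot I N m + a + m.search_from.length +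
        Nat.clog 2 N * (5 * (m.search_from.length + m.runs.length)) +
        7 * (m.search_from.length + m.runs.length) + 12 ≤ k) : Bound I N m k
  | sortTake {m k} (a : ℕ) (U : Finset V) (s : ℕ) (hpc : m.pc = .sortTake) (ho : OuterInv m)
      (ha : a ≤ Fintype.card V) (hw : ∀ x ∈ U, WalkEnds m.pred m.p_f (a + 2) x)
      (hr : ∀ r ∈ m.runs, ∀ x ∈ r, x ∈ U) (hm : ∀ r ∈ m.merged, ∀ x ∈ r, x ∈ U)
      (hf : flatLength m.runs + flatLength m.merged = s)
      (hs : m.runs.length + m.merged.length ≤ s)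
      (hk : basePot I N m + a + flatLength m.runs + 3 * m.runs.length +
        Nat.clog 2 (m.merged.length + (m.runs.length + 1) / 2) * (5 * s) + 3 * s + 11 ≤ k) :
      Bound I N m k
  | sortMerge {m k} (a : ℕ) (U : Finset V) (s : ℕ) (hpc : m.pc = .sortMerge) (ho : OuterInv m)
      (ha : a ≤ Fintype.card V) (hw : ∀ x ∈ U, WalkEnds m.pred m.p_f (a + 2) x)
      (hr : ∀ r ∈ m.runs, ∀ x ∈ r, x ∈ U) (hm : ∀ r ∈ m.merged, ∀ x ∈ r, x ∈ U)
      (hleft : ∀ x ∈ m.left, x ∈ U) (hright : ∀ x ∈ m.right, x ∈ U) (hout : ∀ x ∈ m.out, x ∈ U)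
      (hf : m.left.length + m.right.length + m.out.length +
        flatLength m.runs + flatLength m.merged = s)
      (hs : m.runs.length + m.merged.length + 1 ≤ s)
      (hk : basePot I N m + a + m.left.length + m.right.length + flatLength m.runs +
        3 * m.runs.length +
        Nat.clog 2 (m.merged.length + 1 + (m.runs.length + 1) / 2) * (5 * s) + 3 * s + 12 ≤ k) :
      Bound I N m k
  | tryNext {m k} (a : ℕ) (U : Finset V) (hpc : m.pc = .tryNext) (ho : OuterInv m)
      (ha : a ≤ Fintype.card V) (hw : ∀ x ∈ U, WalkEnds m.pred m.p_f (a + 2) x)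
      (hs : ∀ x ∈ m.search_from, x ∈ U)
      (hk : basePot I N m + a + 3 * m.search_from.length + 10 ≤ k) : Bound I N m k
  | pathStart {m k} (a : ℕ) (U : Finset V) (hpc : m.pc = .pathStart) (ho : OuterInv m)
      (ha : a ≤ Fintype.card V) (hw : ∀ x ∈ U, WalkEnds m.pred m.p_f (a + 2) x)
      (hs : ∀ x ∈ m.search_from, x ∈ U) (hc : m.cur ∈ U)
      (hk : basePot I N m + a + 3 * m.search_from.length + 12 ≤ k) : Bound I N m k
  | pathScan {m k} (a : ℕ) (U : Finset V) (hpc : m.pc = .pathScan) (ho : OuterInv m)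
      (ha : a ≤ Fintype.card V) (hw : ∀ x ∈ U, WalkEnds m.pred m.p_f (a + 2) x)
      (hs : ∀ x ∈ m.search_from, x ∈ U) (hc : m.cur ∈ U)
      (hnd : m.path_stack.Nodup) (hsub : ∀ x ∈ m.path_stack, x ∈ m.visited_ps)
      (hk : basePot I N m + a + 3 * m.search_from.length +
        stackSum (fun _ => 1) 1 m.path_unscanned m.path_stack + 11 ≤ k) : Bound I N m k
  | pathBuild {m k} (a : ℕ) (hpc : m.pc = .pathBuild) (ho : OuterInv m)
      (ha : a ≤ Fintype.card V) (hw : WalkEnds m.pred m.p_f (a + 2) m.cur)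
      (hl : m.path_suf.length + m.path_stack.length ≤ Fintype.card V + 1)
      (hk : basePot I N m + a + m.path_stack.length + 9 ≤ k) : Bound I N m k
  | cycleFound {m k} (a : ℕ) (hpc : m.pc = .cycleFound) (ho : OuterInv m)
      (ha : a ≤ Fintype.card V) (hw : WalkEnds m.pred m.p_f (a + 2) m.cur)
      (hl : m.path_suf.length ≤ Fintype.card V + 1)
      (hk : basePot I N m + a + 8 ≤ k) : Bound I N m k
  | predWalk {m k} (b : ℕ) (hpc : m.pc = .predWalk) (ho : OuterInv m)
      (hw : WalkEnds m.pred m.p_f b m.cur)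
      (hl : m.path_suf.length ≤ Fintype.card V + 1)
      (hl' : m.path_pref.length + b ≤ Fintype.card V + 2)
      (hk : basePot I N m + b + 4 ≤ k) : Bound I N m k
  | cycleConcat {m k} (hpc : m.pc = .cycleConcat) (ho : OuterInv m)
      (hl : m.path_pref.length + m.path_suf.length ≤ 2 * Fintype.card V + 3)
      (hk : basePot I N m + 4 ≤ k) : Bound I N m k
  | cycleDone {m k} (hpc : m.pc = .cycleDone) (ho : OuterInv m)
      (hl : m.cycle.length ≤ 2 * Fintype.card V + 3)
      (hk : basePot I N m + 3 ≤ k) : Bound I N m k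

end Search

end WeightedNestedDFS

namespace WeightedNestedDFS

section Steps

open scoped Classical

variable {V : Type w} {S : Type v} [Fintype V] [Fintype S] {I : Input V S} {N : ℕ} {m : Mem V S}
  {k : ℕ}

/-- The next control point is reached within the bounds, with a smaller potential. -/
def Advances (I : Input V S) (N : ℕ) (m : Mem V S) (k : ℕ) : Prop :=
  ∃ k' < k, Bound I N (step I m) k'

theorem advances_dfsRepeat (hpc : m.pc = .dfsRepeat) (ho : OuterInv m)
    (hk : basePot I N m + 2 ≤ k) : Advances I N m k := by
  unfold Advances
  by_cases h : m.stack_outer = [] ∨ m.weight_max = I.threshold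
  · refine ⟨tailTime I, by unfold basePot at hk; omega, .halts ?_⟩
    simp only [step, hpc, h, if_true]
    exact haltsFrom_returnRun _ rfl ho.stem_le ho.cycle_le
  · refine ⟨basePot I N m + 1, by omega, ?_⟩
    simp only [step, hpc, h, if_false]
    exact .dfsScan rfl ⟨ho.1, ho.2, ho.3, ho.4⟩ le_rfl

theorem advances_dfsScan (hI : I.Layered) (hpc : m.pc = .dfsScan) (ho : OuterInv m)
    (hk : basePot I N m + 1 ≤ k) : Advances I N m k := by
  unfold Advances
  obtain ⟨hnd, hsub, hstem, hcyc⟩ := ho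
  cases hst : m.stack_outer with
  | nil =>
    refine ⟨tailTime I, by unfold basePot at hk; omega, .halts ?_⟩
    simp only [step, hpc, hst]
    exact haltsFrom_returnRun _ rfl hstem hcyc
  | cons p st =>
    rw [hst] at hnd hsub
    have hst' : ∀ q ∈ st, q ∈ m.visited_outer := fun q hq => hsub q (List.mem_cons_of_mem _ hq)
    cases hu : m.unscanned p with
    | nil =>
      by_cases hacc : I.accepting p
      · refine ⟨k - 1, by omega, ?_⟩
        simp only [step, hpc, hst, hu, hacc, if_true]
        refine .cycleStart rfl ⟨hnd.of_cons, hst', hstem, hcyc⟩ (hI.layer_accepting p hacc)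
          (by simp only [Function.update_self]) ?_
        simp only [basePot, hst, stackSum_cons, hu, outerCost, hacc, if_true] at hk ⊢
        omega
      · refine ⟨k - 1, by omega, ?_⟩
        simp only [step, hpc, hst, hu, hacc, if_false]
        refine .dfsRepeat rfl ⟨hnd.of_cons, hst', hstem, hcyc⟩ ?_
        simp only [basePot, hst, stackSum_cons, hu, outerCost, hacc, if_false] at hk ⊢
        omega
    | cons x xs =>
      by_cases hx : x ∈ m.visited_outer
      · refine ⟨k - 1, by omega, ?_⟩
        have h := stackSum_scan (outerCost I) 2 hnd hu
        simp only [step, hpc, hst, hu, hx, if_true]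
        refine .dfsScan rfl ⟨hnd, hsub, hstem, hcyc⟩ ?_
        simp only [basePot, hst] at hk ⊢
        omega
      · refine ⟨k - 1, by omega, ?_⟩
        have hxs : x ∉ p :: st := fun h => hx (hsub x h)
        have h := stackSum_push (outerCost I) 2 hnd hxs hu (I.succ x)
        have h' := unvisitedSum_insert (fun p => 2 * (I.succ p).length + outerCost I p) hx
        simp only [step, hpc, hst, hu, hx, if_false]
        refine .dfsRepeat rfl ⟨List.nodup_cons.2 ⟨hxs, hnd⟩, fun q hq => ?_, hstem, hcyc⟩ ?_
        · rcases List.mem_cons.1 hq with rfl | hq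
          · exact Finset.mem_insert_self _ _
          · exact Finset.mem_insert_of_mem (hsub q hq)
        · simp only [basePot, hst] at hk ⊢
          omega

theorem advances_cycleStart (hpc : m.pc = .cycleStart) (ho : OuterInv m)
    (hl : I.layer m.p_f = 0) (hd : m.dist m.p_f = 0) (hk : basePot I N m + 3 * I.n + 20 ≤ k) :
    Advances I N m k := by
  unfold Advances
  refine ⟨k - 1, by omega, ?_⟩
  simp only [step, hpc]
  refine .clearQueues rfl ⟨ho.1, ho.2, ho.3, ho.4⟩ hl hd rfl le_rfl
    (fun j h h' => absurd h' (by simp only; omega)) ?_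
  simp only [basePot] at hk ⊢
  omega

theorem advances_clearQueues (hN : ∑ p, (I.succ p).length ≤ N) (hpc : m.pc = .clearQueues)
    (ho : OuterInv m) (hl : I.layer m.p_f = 0) (hd : m.dist m.p_f = 0)
    (hq : m.queue_curr = [m.p_f]) (hi : 1 ≤ m.idx)
    (he : ∀ j, 1 ≤ j → j < m.idx → m.queues_all j = [])
    (hk : basePot I N m + (I.n + 1 - m.idx) + 2 * I.n + 18 ≤ k) : Advances I N m k := by
  unfold Advances
  refine ⟨k - 1, by omega, ?_⟩
  by_cases h : m.idx ≤ I.n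
  · simp only [step, hpc, h, if_true]
    refine .clearQueues rfl ⟨ho.1, ho.2, ho.3, ho.4⟩ hl hd hq (Nat.le_add_left _ _)
      (fun j hj hj' => ?_) ?_
    · dsimp only at hj' ⊢
      by_cases hji : j = m.idx
      · rw [hji, Function.update_self]
      · rw [Function.update_of_ne hji]
        exact he j hj (by omega)
    · simp only [basePot] at hk ⊢
      omega
  · simp only [step, hpc, h, if_false]
    have hempty : ∀ j, 0 < j → j ≤ I.n → m.queues_all j = [] :=
      fun j hj hj' => he j hj (by omega)
    refine .propPop (fun _ => 0) ∅ ∅ rfl ⟨ho.1, ho.2, ho.3, ho.4⟩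
      ⟨PredInv.start .., fun _ => hd, hl, ?_, ?_, ?_⟩ ?_ ?_
    · simp only [hq, List.mem_singleton, forall_eq]
      exact ⟨hl, Or.inl ⟨rfl, rfl⟩⟩
    · intro j hj hj' x hx
      simp only [hempty j hj hj', List.not_mem_nil] at hx
    · simp
    · have := unvisitedSum_le (fun p => (I.succ p).length) m.visited_inner
      simp only [candidates, List.length_nil]
      omega
    · simp only [propPot, basePot, hq, laterSize_eq_zero hempty, Finset.card_empty,
        List.length_nil, List.length_singleton] at hk ⊢
      omega

theorem advances_propPop {τ : V → ℕ} {A U : Finset V} (hpc : m.pc = .propPop) (ho : OuterInv m)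
    (hp : PropInv I m τ A U) (hc : candidates I m ≤ N) (hk : propPot I N m A + 14 ≤ k) :
    Advances I N m k := by
  unfold Advances
  refine ⟨k - 1, by omega, ?_⟩
  have hcurr := hp.curr
  cases hq : m.queue_curr with
  | nil =>
    simp only [step, hpc, hq]
    refine .nextLayer τ A U rfl ⟨ho.1, ho.2, ho.3, ho.4⟩
      ⟨hp.1, hp.2, hp.3, by simp, hp.5, hp.6⟩ hc ?_
    simp only [propPot, basePot, hq] at hk ⊢
    omega
  | cons p qs =>
    rw [hq] at hcurr
    have hqs := fun x hx => hcurr x (List.mem_cons_of_mem _ hx)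
    by_cases hv : p ∈ m.visited_inner
    · simp only [step, hpc, hq, hv, if_true]
      refine .propRepeat τ A U rfl ⟨ho.1, ho.2, ho.3, ho.4⟩
        ⟨hp.1, hp.2, hp.3, hqs, hp.5, hp.6⟩ hc ?_
      simp only [propPot, basePot, hq, List.length_cons] at hk ⊢
      omega
    · simp only [step, hpc, hq, hv, if_false]
      have hsrc := hcurr p List.mem_cons_self
      refine .propSucc τ (insert p A) U rfl ⟨ho.1, ho.2, ho.3, ho.4⟩
        ⟨hp.1.process fun hne => ?_, hp.2, hp.3, hqs, hp.5, hp.6⟩ (Finset.mem_insert_self _ _)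
        hsrc (fun _ h => h) ?_ ?_
      · rcases hsrc.2 with h | h
        · exact absurd h.2 hne
        · exact ⟨h.2, hsrc.1.symm ▸ h.1⟩
      · have := unvisitedSum_insert (fun p => (I.succ p).length) hv
        simp only [candidates] at hc ⊢
        omega
      · have h := unvisitedSum_insert (innerCost I N) hv
        have h' := Finset.card_insert_le p A
        rw [innerCost] at h
        simp only [propPot, basePot, hq, List.length_cons] at hk ⊢
        omega

theorem advances_propRepeat {τ : V → ℕ} {A U : Finset V} (hpc : m.pc = .propRepeat)
    (ho : OuterInv m) (hp : PropInv I m τ A U) (hc : candidates I m ≤ N)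
    (hk : propPot I N m A + 15 ≤ k) : Advances I N m k := by
  unfold Advances
  refine ⟨k - 1, by omega, ?_⟩
  by_cases h : m.queue_curr = []
  · simp only [step, hpc, h, if_true]
    refine .nextLayer τ A U rfl ⟨ho.1, ho.2, ho.3, ho.4⟩
      ⟨hp.1, hp.2, hp.3, by simp, hp.5, hp.6⟩ hc ?_
    simp only [propPot, basePot, h] at hk ⊢
    omega
  · simp only [step, hpc, h, if_false]
    refine .propPop τ A U rfl ⟨ho.1, ho.2, ho.3, ho.4⟩
      ⟨hp.1, hp.2, hp.3, hp.4, hp.5, hp.6⟩ hc ?_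
    simp only [propPot, basePot] at hk ⊢
    omega

theorem advances_propSucc (hI : I.Layered) {τ : V → ℕ} {A U : Finset V} (hpc : m.pc = .propSucc)
    (ho : OuterInv m) (hp : PropInv I m τ A U) (hcA : m.cur ∈ A)
    (hs : Source I m.p_f U m.idx m.cur) (hsucc : ∀ x ∈ m.succs, x ∈ I.succ m.cur)
    (hc : candidates I m + m.succs.length ≤ N)
    (hk : propPot I N m A + (3 + sortCharge N) * m.succs.length + 16 ≤ k) : Advances I N m k := by
  unfold Advances
  refine ⟨k - 1, by omega, ?_⟩
  cases hq : m.succs with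
  | nil =>
    rw [hq] at hk hc
    simp only [step, hpc, hq]
    refine .propRepeat τ A U rfl ⟨ho.1, ho.2, ho.3, ho.4⟩ ⟨hp.1, hp.2, hp.3, hp.4, hp.5, hp.6⟩ hc ?_
    simp only [propPot, basePot, List.length_nil] at hk ⊢
    omega
  | cons x xs =>
    rw [hq] at hk hc hsucc
    have hx := hsucc x List.mem_cons_self
    have hxs := fun y hy => hsucc y (List.mem_cons_of_mem x hy)
    simp only [List.length_cons, Nat.mul_add, mul_one] at hk hc
    by_cases hd : m.dist x < m.dist m.cur + I.weight m.cur x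
    · simp only [step, hpc, hq, hd, if_true]
      have hlx : m.idx = 0 → 1 ≤ I.layer x := by
        intro hidx
        by_contra! h
        have hcp : m.cur = m.p_f := by
          rcases hs.2 with h | h
          · exact h.2
          · omega
        rw [hI.weight_eq_zero _ _ hx (Or.inl (by omega)), hcp, hp.dist_pf hidx] at hd
        omega
      have hmem : ∀ {y}, y ∈ U → y ∈ insert x U := fun h => Finset.mem_insert_of_mem h
      have hsrc : ∀ y, Source I m.p_f U m.idx y → Source I m.p_f (insert x U) m.idx y :=
        fun y hy => ⟨hy.1, hy.2.imp id fun h => ⟨h.1, hmem h.2⟩⟩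
      refine .propSucc (Function.update τ x (τ m.cur + 1)) A (insert x U) rfl
        ⟨ho.1, ho.2, ho.3, ho.4⟩
        ⟨hp.1.update hI hcA hx hd, fun hidx => ?_, hp.3, ?_, ?_, ?_⟩ hcA (hsrc _ hs) hxs ?_ ?_
      · have h := hlx hidx
        have hne : m.p_f ≠ x := by
          rintro rfl
          have := hp.layer_pf
          omega
        simpa only [Function.update_of_ne hne] using hp.dist_pf hidx
      · intro y hy
        dsimp only at hy ⊢
        split_ifs at hy with hlay
        · rcases List.mem_append.1 hy with hy | hy
          · exact hsrc y (hp.curr y hy)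
          · rw [List.mem_singleton.1 hy]
            refine ⟨hlay.trans hs.1, Or.inr ⟨?_, Finset.mem_insert_self _ _⟩⟩
            have := hs.1
            by_contra! h
            have := hlx (by omega)
            omega
        · exact hsrc y (hp.curr y hy)
      · intro j hj hj' y hy
        dsimp only at hj hy
        split_ifs at hy with hlay
        · by_cases hjx : j = I.layer x
          · rw [hjx, Function.update_self, ← hjx] at hy
            rcases List.mem_append.1 hy with hy | hy
            · exact ⟨(hp.later j hj hj' y hy).1, hmem (hp.later j hj hj' y hy).2⟩
            · rw [List.mem_singleton.1 hy]
              exact ⟨hjx.symm, Finset.mem_insert_self _ _⟩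
          · rw [Function.update_of_ne hjx] at hy
            exact ⟨(hp.later j hj hj' y hy).1, hmem (hp.later j hj hj' y hy).2⟩
        · exact ⟨(hp.later j hj hj' y hy).1, hmem (hp.later j hj hj' y hy).2⟩
      · intro y hy
        dsimp only at hy
        split_ifs at hy
        · rcases List.mem_cons.1 hy with rfl | hy
          · exact Finset.mem_insert_self _ _
          · exact hmem (hp.search_from y hy)
        · exact hmem (hp.search_from y hy)
      · simp only [candidates] at hc ⊢
        split_ifs <;> (try simp only [List.length_cons]) <;> omega
      · have h1 := laterSize_append_le I.n m.idx m.queues_all (I.layer x) x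
        simp only [propPot, basePot] at hk ⊢
        have h2 : sortCharge N * (if I.layer x = 0 ∧ m.stamp x ≠ some m.p_f
            then x :: m.search_from else m.search_from).length ≤
            sortCharge N * m.search_from.length + sortCharge N := by
          split_ifs
          · rw [List.length_cons, Nat.mul_add, mul_one]
          · exact Nat.le_add_right _ _
        generalize sortCharge N * (if I.layer x = 0 ∧ m.stamp x ≠ some m.p_f
            then x :: m.search_from else m.search_from).length = z at h2 ⊢
        by_cases hlay : I.layer x = I.layer m.cur
        · simp only [hlay, if_true, ne_eq, not_true_eq_false, false_and, if_false,
            List.length_append, List.length_singleton]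
          omega
        · rw [if_neg hlay]
          split_ifs <;> omega
    · simp only [step, hpc, hq, hd, if_false]
      refine .propSucc τ A U rfl ⟨ho.1, ho.2, ho.3, ho.4⟩ ⟨hp.1, hp.2, hp.3, hp.4, hp.5, hp.6⟩ hcA hs
        hxs ?_ ?_
      · simp only [candidates] at hc ⊢
        omega
      · simp only [propPot, basePot] at hk ⊢
        omega

theorem advances_nextLayer {τ : V → ℕ} {A U : Finset V} (hpc : m.pc = .nextLayer)
    (ho : OuterInv m) (hp : PropInv I m τ A U) (hc : candidates I m ≤ N)
    (hk : propPot I N m A + 13 ≤ k) : Advances I N m k := by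
  unfold Advances
  refine ⟨k - 1, by omega, ?_⟩
  by_cases hi : m.idx < I.n
  · have hsize := laterSize_eq_add hi m.queues_all
    have hlater : ∀ j, m.idx + 1 < j → j ≤ I.n → ∀ x ∈ m.queues_all j, I.layer x = j ∧ x ∈ U :=
      fun j hj => hp.later j (by omega)
    by_cases hq : m.queues_all (m.idx + 1) = []
    · simp only [step, hpc, hi, hq, if_true]
      refine .nextLayer τ A U rfl ⟨ho.1, ho.2, ho.3, ho.4⟩
        ⟨hp.1, fun h => absurd h (Nat.succ_ne_zero _), hp.3, by simp, hlater, hp.6⟩ hc ?_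
      simp only [propPot, basePot, List.length_nil] at hk ⊢
      omega
    · simp only [step, hpc, hi, hq, if_true, if_false]
      refine .propPop τ A U rfl ⟨ho.1, ho.2, ho.3, ho.4⟩
        ⟨hp.1, fun h => absurd h (Nat.succ_ne_zero _), hp.3, fun x hx => ?_, hlater, hp.6⟩ hc ?_
      · have h := hp.later (m.idx + 1) (by omega) hi x hx
        exact ⟨h.1, Or.inr ⟨Nat.le_add_left _ _, h.2⟩⟩
      · simp only [propPot, basePot] at hk ⊢
        omega
  · simp only [step, hpc, hi, if_false]
    refine .sortSplit A.card U rfl ⟨ho.1, ho.2, ho.3, ho.4⟩ (Finset.card_le_univ A)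
      (fun x hx => hp.predInv.walkEnds hx) hp.search_from (by simp) rfl rfl ?_ ?_
    · simp only [candidates] at hc
      simp only [List.length_nil]
      omega
    · have h : sortCharge N * m.search_from.length =
          Nat.clog 2 N * (5 * m.search_from.length) + 8 * m.search_from.length := by
        unfold sortCharge
        ring
      simp only [propPot, basePot, List.length_nil, add_zero] at hk ⊢
      omega

theorem advances_sortSplit {a : ℕ} {U : Finset V} (hpc : m.pc = .sortSplit) (ho : OuterInv m)
    (ha : a ≤ Fintype.card V) (hw : ∀ x ∈ U, WalkEnds m.pred m.p_f (a + 2) x)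
    (hs : ∀ x ∈ m.search_from, x ∈ U) (hr : ∀ r ∈ m.runs, ∀ x ∈ r, x ∈ U)
    (hf : flatLength m.runs = m.runs.length) (hm : m.merged = [])
    (hN : m.search_from.length + m.runs.length ≤ N)
    (hk : basePot I N m + a + m.search_from.length +
      Nat.clog 2 N * (5 * (m.search_from.length + m.runs.length)) +
      7 * (m.search_from.length + m.runs.length) + 12 ≤ k) : Advances I N m k := by
  unfold Advances
  refine ⟨k - 1, by omega, ?_⟩
  cases hq : m.search_from with
  | nil =>
    rw [hq] at hk hN
    simp only [step, hpc, hq]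
    refine .sortTake a U m.runs.length rfl ⟨ho.1, ho.2, ho.3, ho.4⟩ ha hw hr (by simp [hm])
      ?_ ?_ ?_
    · simp only [hm, flatLength_nil, hf, add_zero]
    · simp only [hm, List.length_nil, add_zero, le_refl]
    · have h : Nat.clog 2 ((m.runs.length + 1) / 2) * (5 * m.runs.length) ≤
          Nat.clog 2 N * (5 * m.runs.length) := by
        refine Nat.mul_le_mul_right _ (Nat.clog_mono_right 2 ?_)
        simp only [List.length_nil] at hN
        omega
      simp only [basePot, hm, hf, List.length_nil, zero_add] at hk ⊢
      omega
  | cons p ps =>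
    rw [hq] at hk hN hs
    have hlen : (p :: ps).length + m.runs.length = ps.length + ([p] :: m.runs).length := by
      simp only [List.length_cons]
      omega
    simp only [step, hpc, hq]
    refine .sortSplit a U rfl ⟨ho.1, ho.2, ho.3, ho.4⟩ ha hw
      (fun x hx => hs x (List.mem_cons_of_mem _ hx)) ?_ ?_ hm (hlen ▸ hN) ?_
    · intro r hr' x hx
      rcases List.mem_cons.1 hr' with rfl | hr'
      · exact hs x (List.mem_singleton.1 hx ▸ List.mem_cons_self)
      · exact hr r hr' x hx
    · simp only [flatLength_cons, List.length_cons, List.length_nil, hf]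
      omega
    · rw [hlen] at hk
      simp only [basePot, List.length_cons] at hk ⊢
      omega

theorem advances_sortTake {a : ℕ} {U : Finset V} {s : ℕ} (hpc : m.pc = .sortTake)
    (ho : OuterInv m) (ha : a ≤ Fintype.card V) (hw : ∀ x ∈ U, WalkEnds m.pred m.p_f (a + 2) x)
    (hr : ∀ r ∈ m.runs, ∀ x ∈ r, x ∈ U) (hm : ∀ r ∈ m.merged, ∀ x ∈ r, x ∈ U)
    (hf : flatLength m.runs + flatLength m.merged = s)
    (hs : m.runs.length + m.merged.length ≤ s)
    (hk : basePot I N m + a + flatLength m.runs + 3 * m.runs.length +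
      Nat.clog 2 (m.merged.length + (m.runs.length + 1) / 2) * (5 * s) + 3 * s + 11 ≤ k) :
    Advances I N m k := by
  unfold Advances
  refine ⟨k - 1, by omega, ?_⟩
  rcases hq : m.runs with _ | ⟨r₁, _ | ⟨r₂, rs⟩⟩
  · rcases hq' : m.merged with _ | ⟨g₁, _ | ⟨g₂, gs⟩⟩
    · simp only [step, hpc, hq, hq']
      refine .tryNext a U rfl ⟨ho.1, ho.2, ho.3, ho.4⟩ ha hw (by simp) ?_
      simp only [basePot, List.length_nil] at hk ⊢
      omega
    · rw [hq, hq'] at hf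
      rw [hq'] at hm
      simp only [step, hpc, hq, hq']
      refine .tryNext a U rfl ⟨ho.1, ho.2, ho.3, ho.4⟩ ha hw (hm g₁ List.mem_cons_self) ?_
      simp only [flatLength_nil, flatLength_cons] at hf
      simp only [basePot] at hk ⊢
      omega
    · rw [hq, hq'] at hf hk hs
      rw [hq'] at hm
      simp only [step, hpc, hq, hq']
      refine .sortTake a U s rfl ⟨ho.1, ho.2, ho.3, ho.4⟩ ha hw hm (by simp) ?_ ?_ ?_
      · rw [add_comm]; exact hf
      · rw [add_comm]; exact hs
      · have h : Nat.clog 2 (g₁ :: g₂ :: gs).length =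
            Nat.clog 2 (((g₁ :: g₂ :: gs).length + 1) / 2) + 1 := by
          rw [Nat.clog_of_two_le one_lt_two (by simp)]
          rfl
        have h0 : ∀ g : ℕ, g + (([] : List (List V)).length + 1) / 2 = g := fun g => by simp
        have h2 : 2 ≤ (g₁ :: g₂ :: gs).length := by simp
        rw [h0] at hk
        simp only [List.length_nil, flatLength_nil, zero_add, add_zero] at hk hf hs ⊢
        rw [h, add_mul, one_mul] at hk
        simp only [basePot] at hk ⊢
        omega
  · rw [hq] at hf hk hs hr
    simp only [step, hpc, hq]
    refine .sortTake a U s rfl ⟨ho.1, ho.2, ho.3, ho.4⟩ ha hw (by simp) ?_ ?_ ?_ ?_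
    · intro r hr' x hx
      rcases List.mem_cons.1 hr' with rfl | hr'
      · exact hr r List.mem_cons_self x hx
      · exact hm r hr' x hx
    · simp only [flatLength_cons, flatLength_nil] at hf ⊢
      omega
    · simp only [List.length_cons, List.length_nil] at hs ⊢
      omega
    · simp only [basePot, List.length_cons, List.length_nil, flatLength_nil, flatLength_cons,
        zero_add, add_zero, Nat.reduceAdd, Nat.reduceDiv] at hk ⊢
      omega
  · rw [hq] at hf hk hs hr
    have hdiv : ((r₁ :: r₂ :: rs).length + 1) / 2 = 1 + (rs.length + 1) / 2 := by
      simp only [List.length_cons]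
      omega
    rw [hdiv, ← add_assoc] at hk
    simp only [step, hpc, hq]
    refine .sortMerge a U s rfl ⟨ho.1, ho.2, ho.3, ho.4⟩ ha hw
      (fun r hr' => hr r (List.mem_cons_of_mem _ (List.mem_cons_of_mem _ hr'))) hm
      (hr r₁ List.mem_cons_self) (hr r₂ (List.mem_cons_of_mem _ List.mem_cons_self)) (by simp)
      ?_ ?_ ?_
    · simp only [flatLength_cons, List.length_nil] at hf ⊢
      omega
    · simp only [List.length_cons] at hs ⊢
      omega
    · simp only [basePot, List.length_cons, flatLength_cons] at hk ⊢
      omega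

theorem advances_sortMerge {a : ℕ} {U : Finset V} {s : ℕ} (hpc : m.pc = .sortMerge)
    (ho : OuterInv m) (ha : a ≤ Fintype.card V) (hw : ∀ x ∈ U, WalkEnds m.pred m.p_f (a + 2) x)
    (hr : ∀ r ∈ m.runs, ∀ x ∈ r, x ∈ U) (hm : ∀ r ∈ m.merged, ∀ x ∈ r, x ∈ U)
    (hleft : ∀ x ∈ m.left, x ∈ U) (hright : ∀ x ∈ m.right, x ∈ U) (hout : ∀ x ∈ m.out, x ∈ U)
    (hf : m.left.length + m.right.length + m.out.length +
      flatLength m.runs + flatLength m.merged = s)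
    (hs : m.runs.length + m.merged.length + 1 ≤ s)
    (hk : basePot I N m + a + m.left.length + m.right.length + flatLength m.runs +
      3 * m.runs.length +
      Nat.clog 2 (m.merged.length + 1 + (m.runs.length + 1) / 2) * (5 * s) + 3 * s + 12 ≤ k) :
    Advances I N m k := by
  unfold Advances
  refine ⟨k - 1, by omega, ?_⟩
  have happend : ∀ x ∈ U, ∀ y ∈ m.out ++ [x], y ∈ U := by
    intro x hx y hy
    rcases List.mem_append.1 hy with hy | hy
    · exact hout y hy
    · exact List.mem_singleton.1 hy ▸ hx
  have htake : ∀ l r : List V, ∀ x ∈ U, (∀ y ∈ l, y ∈ U) → (∀ y ∈ r, y ∈ U) →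
      l.length + r.length + 1 = m.left.length + m.right.length →
      Bound I N { m with left := l, right := r, out := m.out ++ [x] } (k - 1) := by
    intro l r x hx hl hr' hlen
    refine .sortMerge a U s hpc ⟨ho.1, ho.2, ho.3, ho.4⟩ ha hw hr hm hl hr' (happend x hx) ?_ hs ?_
    · simp only [List.length_append, List.length_singleton]
      omega
    · simp only [basePot] at hk ⊢
      omega
  rcases hq : m.left with _ | ⟨x, l⟩
  · rcases hq' : m.right with _ | ⟨y, r⟩
    · rw [hq, hq'] at hf hk
      simp only [step, hpc, hq, hq']
      refine .sortTake a U s rfl ⟨ho.1, ho.2, ho.3, ho.4⟩ ha hw hr ?_ ?_ ?_ ?_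
      · intro r hr' x hx
        rcases List.mem_cons.1 hr' with rfl | hr'
        · exact hout x hx
        · exact hm r hr' x hx
      · simp only [flatLength_cons, List.length_nil] at hf ⊢
        omega
      · simp only [List.length_cons]
        omega
      · simp only [basePot, List.length_nil, List.length_cons] at hk ⊢
        omega
    · have h := htake [] r y (hright y (hq' ▸ List.mem_cons_self)) (by simp)
        (fun z hz => hright z (hq' ▸ List.mem_cons_of_mem _ hz)) (by simp [hq, hq'])
      simp only [step, hpc, hq, hq'] at h ⊢
      exact h
  · have hx : x ∈ U := hleft x (hq ▸ List.mem_cons_self)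
    have hl : ∀ z ∈ l, z ∈ U := fun z hz => hleft z (hq ▸ List.mem_cons_of_mem _ hz)
    rcases hq' : m.right with _ | ⟨y, r⟩
    · have h := htake l [] x hx hl (by simp) (by simp [hq, hq'])
      simp only [step, hpc, hq, hq'] at h ⊢
      exact h
    · by_cases hd : m.dist y ≤ m.dist x
      · have h := htake l (y :: r) x hx hl (hq' ▸ hright) (by simp [hq, hq']; omega)
        simp only [step, hpc, hq, hq', hd, if_true] at h ⊢
        exact h
      · have h := htake (x :: l) r y (hright y (hq' ▸ List.mem_cons_self)) (hq ▸ hleft)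
          (fun z hz => hright z (hq' ▸ List.mem_cons_of_mem _ hz)) (by simp [hq, hq']; omega)
        simp only [step, hpc, hq, hq', hd, if_false] at h ⊢
        exact h

theorem advances_tryNext {a : ℕ} {U : Finset V} (hpc : m.pc = .tryNext) (ho : OuterInv m)
    (ha : a ≤ Fintype.card V) (hw : ∀ x ∈ U, WalkEnds m.pred m.p_f (a + 2) x)
    (hs : ∀ x ∈ m.search_from, x ∈ U)
    (hk : basePot I N m + a + 3 * m.search_from.length + 10 ≤ k) : Advances I N m k := by
  unfold Advances
  refine ⟨k - 1, by omega, ?_⟩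
  cases hq : m.search_from with
  | nil =>
    simp only [step, hpc, hq]
    refine .cycleDone rfl ⟨ho.1, ho.2, ho.3, ho.4⟩ (by simp) ?_
    simp only [basePot] at hk ⊢
    omega
  | cons p ps =>
    rw [hq] at hs hk
    simp only [step, hpc, hq]
    refine .pathStart a U rfl ⟨ho.1, ho.2, ho.3, ho.4⟩ ha hw
      (fun x hx => hs x (List.mem_cons_of_mem _ hx)) (hs p List.mem_cons_self) ?_
    simp only [basePot, List.length_cons] at hk ⊢
    omega

theorem advances_pathStart {a : ℕ} {U : Finset V} (hpc : m.pc = .pathStart) (ho : OuterInv m)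
    (ha : a ≤ Fintype.card V) (hw : ∀ x ∈ U, WalkEnds m.pred m.p_f (a + 2) x)
    (hs : ∀ x ∈ m.search_from, x ∈ U) (hc : m.cur ∈ U)
    (hk : basePot I N m + a + 3 * m.search_from.length + 12 ≤ k) : Advances I N m k := by
  unfold Advances
  refine ⟨k - 1, by omega, ?_⟩
  by_cases h : m.cur = m.p_f
  · have e : step I m = { m with path_suf := [m.p_f], pc := .cycleFound } := by
      simp only [step, hpc, if_pos h]
    rw [e]
    refine .cycleFound a rfl ⟨ho.1, ho.2, ho.3, ho.4⟩ ha (hw _ hc) (by simp) ?_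
    simp only [basePot] at hk ⊢
    omega
  · by_cases h' : m.cur ∈ m.visited_ps
    · simp only [step, hpc, h, h', if_true, if_false]
      refine .tryNext a U rfl ⟨ho.1, ho.2, ho.3, ho.4⟩ ha hw hs ?_
      simp only [basePot] at hk ⊢
      omega
    · have hv := unvisitedSum_insert (fun p => (I.succ p).length + 1) h'
      simp only [step, hpc, h, h', if_false]
      refine .pathScan a U rfl ⟨ho.1, ho.2, ho.3, ho.4⟩ ha hw hs hc (List.nodup_singleton _)
        (by simp) ?_
      simp only [basePot, stackSum_cons, stackSum_nil, Function.update_self] at hk ⊢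
      omega

theorem advances_pathScan {a : ℕ} {U : Finset V} (hpc : m.pc = .pathScan) (ho : OuterInv m)
    (ha : a ≤ Fintype.card V) (hw : ∀ x ∈ U, WalkEnds m.pred m.p_f (a + 2) x)
    (hs : ∀ x ∈ m.search_from, x ∈ U) (hc : m.cur ∈ U)
    (hnd : m.path_stack.Nodup) (hsub : ∀ x ∈ m.path_stack, x ∈ m.visited_ps)
    (hk : basePot I N m + a + 3 * m.search_from.length +
      stackSum (fun _ => 1) 1 m.path_unscanned m.path_stack + 11 ≤ k) : Advances I N m k := by
  unfold Advances
  refine ⟨k - 1, by omega, ?_⟩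
  cases hst : m.path_stack with
  | nil =>
    simp only [step, hpc, hst]
    refine .tryNext a U rfl ⟨ho.1, ho.2, ho.3, ho.4⟩ ha hw hs ?_
    simp only [basePot] at hk ⊢
    omega
  | cons p st =>
    rw [hst] at hnd hsub hk
    cases hu : m.path_unscanned p with
    | nil =>
      simp only [step, hpc, hst, hu]
      refine .pathScan a U rfl ⟨ho.1, ho.2, ho.3, ho.4⟩ ha hw hs hc hnd.of_cons
        (fun x hx => hsub x (List.mem_cons_of_mem _ hx)) ?_
      simp only [basePot, stackSum_cons, hu] at hk ⊢
      omega
    | cons x xs =>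
      by_cases hx : x = m.p_f
      · have e : step I m = { m with path_suf := [m.p_f], pc := .pathBuild } := by
          simp only [step, hpc, hst, hu, if_pos hx]
        rw [e]
        refine .pathBuild a rfl ⟨ho.1, ho.2, ho.3, ho.4⟩ ha (hw _ hc) ?_ ?_
        · have := hnd.length_le_card
          simp only [hst, List.length_singleton]
          omega
        · have := length_le_stackSum m.path_unscanned (p :: st)
          simp only [basePot, hst] at hk ⊢
          omega
      · by_cases hx' : x ∈ m.visited_ps
        · have h := stackSum_scan (fun _ => 1) 1 hnd hu
          simp only [step, hpc, hst, hu, hx, hx', if_true, if_false]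
          refine .pathScan a U rfl ⟨ho.1, ho.2, ho.3, ho.4⟩ ha hw hs hc hnd hsub ?_
          simp only [basePot] at hk ⊢
          omega
        · have hxs : x ∉ p :: st := fun h => hx' (hsub x h)
          have h := stackSum_push (fun _ => 1) 1 hnd hxs hu (I.succ x)
          have h' := unvisitedSum_insert (fun p => (I.succ p).length + 1) hx'
          simp only [step, hpc, hst, hu, hx, hx', if_false]
          refine .pathScan a U rfl ⟨ho.1, ho.2, ho.3, ho.4⟩ ha hw hs hc
            (List.nodup_cons.2 ⟨hxs, hnd⟩) (fun y hy => ?_) ?_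
          · rcases List.mem_cons.1 hy with rfl | hy
            · exact Finset.mem_insert_self _ _
            · exact Finset.mem_insert_of_mem (hsub y hy)
          · simp only [basePot] at hk ⊢
            omega

theorem advances_pathBuild {a : ℕ} (hpc : m.pc = .pathBuild) (ho : OuterInv m)
    (ha : a ≤ Fintype.card V) (hw : WalkEnds m.pred m.p_f (a + 2) m.cur)
    (hl : m.path_suf.length + m.path_stack.length ≤ Fintype.card V + 1)
    (hk : basePot I N m + a + m.path_stack.length + 9 ≤ k) : Advances I N m k := by
  unfold Advances
  refine ⟨k - 1, by omega, ?_⟩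
  cases hst : m.path_stack with
  | nil =>
    simp only [step, hpc, hst]
    refine .cycleFound a rfl ⟨ho.1, ho.2, ho.3, ho.4⟩ ha hw ((Nat.le_add_right _ _).trans hl) ?_
    simp only [basePot] at hk ⊢
    omega
  | cons p st =>
    rw [hst] at hl hk
    simp only [step, hpc, hst]
    refine .pathBuild a rfl ⟨ho.1, ho.2, ho.3, ho.4⟩ ha hw ?_ ?_
    · simp only [List.length_cons] at hl ⊢
      omega
    · simp only [basePot, List.length_cons] at hk ⊢
      omega

theorem advances_cycleFound {a : ℕ} (hpc : m.pc = .cycleFound) (ho : OuterInv m)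
    (ha : a ≤ Fintype.card V) (hw : WalkEnds m.pred m.p_f (a + 2) m.cur)
    (hl : m.path_suf.length ≤ Fintype.card V + 1) (hk : basePot I N m + a + 8 ≤ k) :
    Advances I N m k := by
  unfold Advances
  refine ⟨k - 1, by omega, ?_⟩
  simp only [step, hpc]
  refine .predWalk (a + 2) rfl ⟨ho.1, ho.2, ho.3, ho.4⟩ hw hl ?_ ?_
  · simp only [List.length_nil]
    omega
  · simp only [basePot] at hk ⊢
    omega

theorem advances_predWalk {b : ℕ} (hpc : m.pc = .predWalk) (ho : OuterInv m)
    (hw : WalkEnds m.pred m.p_f b m.cur) (hl : m.path_suf.length ≤ Fintype.card V + 1)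
    (hl' : m.path_pref.length + b ≤ Fintype.card V + 2) (hk : basePot I N m + b + 4 ≤ k) :
    Advances I N m k := by
  unfold Advances
  refine ⟨k - 1, by omega, ?_⟩
  cases b with
  | zero => exact hw.elim
  | succ b =>
    cases hp : m.pred m.cur with
    | none =>
      simp only [step, hpc, hp]
      refine .cycleConcat rfl ⟨ho.1, ho.2, ho.3, ho.4⟩ ?_ ?_
      · dsimp only
        omega
      · simp only [basePot] at hk ⊢
        omega
    | some q =>
      by_cases hq : q = m.p_f
      · have e : step I m = { m with
            path_pref := q :: m.path_pref, cur := q, pc := .cycleConcat } := by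
          simp only [step, hpc, hp, if_pos hq]
        rw [e]
        refine .cycleConcat rfl ⟨ho.1, ho.2, ho.3, ho.4⟩ ?_ ?_
        · simp only [List.length_cons]
          omega
        · simp only [basePot] at hk ⊢
          omega
      · have hw' := (hw q hp).resolve_left hq
        simp only [step, hpc, hp, hq, if_false]
        refine .predWalk b rfl ⟨ho.1, ho.2, ho.3, ho.4⟩ hw' hl ?_ ?_
        · simp only [List.length_cons]
          omega
        · simp only [basePot] at hk ⊢
          omega

theorem advances_cycleConcat (hpc : m.pc = .cycleConcat) (ho : OuterInv m)
    (hl : m.path_pref.length + m.path_suf.length ≤ 2 * Fintype.card V + 3)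
    (hk : basePot I N m + 4 ≤ k) : Advances I N m k := by
  unfold Advances
  refine ⟨k - 1, by omega, ?_⟩
  simp only [step, hpc]
  refine .cycleDone rfl ⟨ho.1, ho.2, ho.3, ho.4⟩ ?_ ?_
  · simpa only [List.length_append] using hl
  · simp only [basePot] at hk ⊢
    omega

theorem advances_cycleDone (hpc : m.pc = .cycleDone) (ho : OuterInv m)
    (hl : m.cycle.length ≤ 2 * Fintype.card V + 3) (hk : basePot I N m + 3 ≤ k) :
    Advances I N m k := by
  unfold Advances
  refine ⟨k - 1, by omega, ?_⟩
  by_cases h : m.weight_max < m.dist m.p_f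
  · simp only [step, hpc, h, if_true]
    refine .dfsRepeat rfl ⟨ho.1, ho.2, ho.nodup.length_le_card, hl⟩ ?_
    simp only [basePot] at hk ⊢
    omega
  · simp only [step, hpc, h, if_false]
    refine .dfsRepeat rfl ⟨ho.1, ho.2, ho.3, ho.4⟩ ?_
    simp only [basePot] at hk ⊢
    omega

theorem Bound.haltsFrom (hI : I.Layered) (hN : ∑ p, (I.succ p).length ≤ N) (h : Bound I N m k) :
    HaltsFrom I m k := by
  induction k using Nat.strong_induction_on generalizing m with
  | _ k ih =>
    have of_advances : Advances I N m k → HaltsFrom I m k :=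
      fun ⟨k', hk', hb⟩ => (ih k' hk' hb).of_step hk'
    cases h with
    | halts h => exact h
    | dfsScan hpc ho hk => exact of_advances (advances_dfsScan hI hpc ho hk)
    | dfsRepeat hpc ho hk => exact of_advances (advances_dfsRepeat hpc ho hk)
    | cycleStart hpc ho hl hd hk => exact of_advances (advances_cycleStart hpc ho hl hd hk)
    | clearQueues hpc ho hl hd hq hi he hk =>
      exact of_advances (advances_clearQueues hN hpc ho hl hd hq hi he hk)
    | propPop τ A U hpc ho hp hc hk => exact of_advances (advances_propPop hpc ho hp hc hk)
    | propSucc τ A U hpc ho hp hcA hs hsucc hc hk =>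
      exact of_advances (advances_propSucc hI hpc ho hp hcA hs hsucc hc hk)
    | propRepeat τ A U hpc ho hp hc hk => exact of_advances (advances_propRepeat hpc ho hp hc hk)
    | nextLayer τ A U hpc ho hp hc hk => exact of_advances (advances_nextLayer hpc ho hp hc hk)
    | sortSplit a U hpc ho ha hw hs hr hf hm hN hk =>
      exact of_advances (advances_sortSplit hpc ho ha hw hs hr hf hm hN hk)
    | sortTake a U s hpc ho ha hw hr hm hf hs hk =>
      exact of_advances (advances_sortTake hpc ho ha hw hr hm hf hs hk)
    | sortMerge a U s hpc ho ha hw hr hm hleft hright hout hf hs hk =>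
      exact of_advances (advances_sortMerge hpc ho ha hw hr hm hleft hright hout hf hs hk)
    | tryNext a U hpc ho ha hw hs hk => exact of_advances (advances_tryNext hpc ho ha hw hs hk)
    | pathStart a U hpc ho ha hw hs hc hk =>
      exact of_advances (advances_pathStart hpc ho ha hw hs hc hk)
    | pathScan a U hpc ho ha hw hs hc hnd hsub hk =>
      exact of_advances (advances_pathScan hpc ho ha hw hs hc hnd hsub hk)
    | pathBuild a hpc ho ha hw hl hk => exact of_advances (advances_pathBuild hpc ho ha hw hl hk)
    | cycleFound a hpc ho ha hw hl hk => exact of_advances (advances_cycleFound hpc ho ha hw hl hk)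
    | predWalk b hpc ho hw hl hl' hk => exact of_advances (advances_predWalk hpc ho hw hl hl' hk)
    | cycleConcat hpc ho hl hk => exact of_advances (advances_cycleConcat hpc ho hl hk)
    | cycleDone hpc ho hl hk => exact of_advances (advances_cycleDone hpc ho hl hk)

end Steps

end WeightedNestedDFS

namespace WeightedNestedDFS

section RunningTime

open scoped Classical

variable {V : Type w} {S : Type v} [Fintype V]

theorem sum_outerCost (I : Input V S) :
    ∑ p, outerCost I p = 2 * Fintype.card V +
      (Finset.univ.filter fun p => I.accepting p).card * (3 * I.n + 20) := by
  simp only [outerCost, Finset.sum_add_distrib, Finset.sum_ite, Finset.sum_const, smul_eq_mul,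
    Finset.card_univ, mul_zero, add_zero]
  ring

variable [Fintype S]

/-- An upper bound for the running time after the initialization. -/
noncomputable def searchTime (I : Input V S) (N : ℕ) : ℕ :=
  ∑ p, (2 * (I.succ p).length + outerCost I p) + ∑ p, innerCost I N p +
    ∑ p, ((I.succ p).length + 1) + tailTime I + 2

theorem haltsFrom_dfsStart {I : Input V S} {N : ℕ} (hI : I.Layered)
    (hN : ∑ p, (I.succ p).length ≤ N) (m : Mem V S) (hpc : m.pc = .dfsStart)
    (hs : m.stem_max = []) (hc : m.cycle_max = []) : HaltsFrom I m (searchTime I N) := by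
  refine HaltsFrom.of_step (k := searchTime I N - 1) (Bound.haltsFrom hI hN ?_)
    (by unfold searchTime; omega)
  have h := unvisitedSum_insert (fun p => 2 * (I.succ p).length + outerCost I p)
    (Finset.notMem_empty I.start)
  have h1 := unvisitedSum_le (fun p => 2 * (I.succ p).length + outerCost I p) ∅
  have h2 := unvisitedSum_le (innerCost I N) m.visited_inner
  have h3 := unvisitedSum_le (fun p => (I.succ p).length + 1) m.visited_ps
  have h4 : ({I.start} : Finset V) = insert I.start ∅ := rfl
  simp only [step, hpc]
  refine .dfsScan rfl ⟨List.nodup_singleton _, by simp, by simp [hs], by simp [hc]⟩ ?_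
  simp only [basePot, searchTime, stackSum_cons, stackSum_nil, Function.update_self, h4]
  omega

theorem haltsFrom_setup {I : Input V S} {N : ℕ} (hI : I.Layered)
    (hN : ∑ p, (I.succ p).length ≤ N) (l : List V) (m : Mem V S) (hpc : m.pc = .setup)
    (hl : m.todo = l) (hs : m.stem_max = []) (hc : m.cycle_max = []) :
    HaltsFrom I m (l.length + 1 + searchTime I N) := by
  induction l generalizing m with
  | cons p l ih =>
    refine (ih (step I m) ?_ ?_ ?_ ?_).of_step (by simp) <;> simp [step, hpc, hl, hs, hc]
  | nil =>
    refine (haltsFrom_dfsStart (N := N) hI hN (step I m) ?_ ?_ ?_).of_step (by simp) <;>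
      simp [step, hpc, hl, hs, hc]

theorem haltsWithin_of_layered {I : Input V S} {N : ℕ} (hI : I.Layered)
    (hN : ∑ p, (I.succ p).length ≤ N) :
    HaltsWithin I (I.states.length + 1 + searchTime I N) :=
  haltsFrom_setup hI hN I.states (initial I) rfl rfl rfl rfl

/-- The running time, if the accepting states are few compared with the number of layers. -/
theorem searchTime_le {I : Input V S} {N : ℕ}
    (hsize : Fintype.card V + ∑ p, (I.succ p).length = N)
    (ht : ∑ s, ((I.tsucc s).length + 1) ≤ N)
    (hacc : (Finset.univ.filter fun p => I.accepting p).card * (I.n + 1) ≤ Fintype.card V) :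
    searchTime I N ≤ 50 * N + 5 * (Nat.clog 2 N * N) + 8 := by
  have h1 : (Finset.univ.filter fun p => I.accepting p).card * (3 * I.n + 20) ≤
      20 * Fintype.card V := by
    refine le_trans ?_ (Nat.mul_le_mul_left 20 hacc)
    rw [mul_left_comm]
    exact Nat.mul_le_mul_left _ (by omega)
  have h2 : ∑ p, innerCost I N p =
      11 * (∑ p, (I.succ p).length) + 5 * (Nat.clog 2 N * ∑ p, (I.succ p).length) +
        2 * Fintype.card V := by
    simp only [innerCost, sortCharge, Finset.sum_add_distrib, ← Finset.mul_sum, Finset.sum_const,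
      smul_eq_mul, Finset.card_univ]
    ring
  have h3 : Nat.clog 2 N * ∑ p, (I.succ p).length ≤ Nat.clog 2 N * N :=
    Nat.mul_le_mul_left _ (by omega)
  simp only [searchTime, Finset.sum_add_distrib, sum_outerCost, h2, ← Finset.mul_sum, tailTime,
    Finset.sum_const, smul_eq_mul, Finset.card_univ, mul_one] at ht ⊢
  omega

end RunningTime

end WeightedNestedDFS

theorem AdjacencyLists.sum_length_succ {V : Type w} [Fintype V] {E : V → V → Prop}
    (adj : AdjacencyLists E) :
    ∑ p, (adj.succ p).length = Nat.card {e : V × V // E e.1 e.2} := by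
  classical
  rw [Nat.card_congr (Equiv.subtypeProdEquivSigmaSubtype E), Nat.card_sigma]
  refine Finset.sum_congr rfl fun p _ => ?_
  rw [Nat.card_congr (Equiv.subtypeEquivRight fun x =>
    ((List.mem_toFinset.trans (adj.mem_succ p x)).symm)), Nat.card_eq_fintype_card,
    Fintype.card_coe, List.toFinset_card_of_nodup (adj.nodup p)]

theorem Listing.length_list {V : Type w} [Fintype V] (l : Listing V) :
    l.list.length = Fintype.card V := by
  classical
  rw [← List.toFinset_card_of_nodup l.nodup, ← Finset.card_univ]
  congr 1
  ext p
  simp [l.mem_list p]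

namespace WeightedNestedDFS

section Mission

variable {AP : Type u} {n : ℕ} {T : TransitionSystem.{u, v} AP} {G : Fin n → GBA.{u, w} (Set AP)}
  {rew : Fin n → ℕ}

theorem missionInput_layered (states : Listing (missionProduct T G rew).Q)
    (adj : AdjacencyLists (missionProduct T G rew).δ) (tadj : AdjacencyLists T.R) (threshold : ℕ) :
    (missionInput T G rew states adj tadj threshold).Layered where
  layer_accepting := by
    rintro ⟨s, q, c⟩ (rfl : c = none)
    rfl
  weight_eq_zero := by
    rintro ⟨s, q, c⟩ ⟨s', q', c'⟩ - h
    change Component.layer c' = 0 ∨ Component.layer c' = Component.layer c at h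
    change Component.weight rew c c' = 0
    rcases c' with _ | ⟨j', l'⟩
    · rcases c with _ | ⟨j, l⟩ <;> rfl
    · rcases c with _ | ⟨j, l⟩
      · simp [Component.layer] at h
      · simp only [Component.layer, Nat.add_eq_zero_iff, one_ne_zero, and_false, false_or,
          Nat.add_right_cancel_iff] at h
        exact if_pos (Fin.ext h.symm)
  layer_le := by
    rintro ⟨s, q, c⟩ ⟨s', q', c'⟩ hx hl
    change Component.layer c ≤ Component.layer c'
    have hmove : Component.Move q c c' := ((adj.mem_succ _ _).1 hx).2.2
    rcases c with _ | ⟨j, l⟩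
    · exact Nat.zero_le _
    · rcases c' with _ | ⟨j', l'⟩
      · exact absurd hl (by simp [missionInput, Component.layer])
      · rcases hmove with h | h | h
        · exact Nat.succ_le_succ h.1.ge
        · exact Nat.succ_le_succ h.1.ge
        · exact Nat.succ_le_succ h.2.1.le

/-- Every accepting state comes with a state for each formula. -/
theorem card_accepting_mul_le (hm : ∀ i, 1 ≤ (G i).m) :
    Nat.card {p // p ∈ (missionProduct T G rew).F} * (n + 1) ≤
      Nat.card (missionProduct T G rew).Q := by
  have : Finite (T.S × (weightedBuchi G rew).Q) := (missionProduct T G rew).finite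
  have h := Nat.card_le_card_of_injective
    (fun x : {p // p ∈ (missionProduct T G rew).F} × Option (Fin n) =>
      ((x.1.1.1, x.1.1.2.1, x.2.map fun j => ⟨j, ⟨0, hm j⟩⟩) : (missionProduct T G rew).Q))
    (by
      rintro ⟨⟨⟨s, q, c⟩, hc⟩, o⟩ ⟨⟨⟨s', q', c'⟩, hc'⟩, o'⟩ heq
      obtain rfl : c = none := hc
      obtain rfl : c' = none := hc'
      obtain ⟨rfl, heq⟩ := Prod.mk.inj heq
      obtain ⟨rfl, ho⟩ := Prod.mk.inj heq
      obtain rfl : o = o' :=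
        Option.map_injective (fun i j hij => (Sigma.mk.inj hij).1) ho
      rfl)
  rwa [Nat.card_prod, Finite.card_option, Nat.card_fin] at h

/-- The transition system is not larger than the product automaton. -/
theorem size_le_size_missionProduct (hG : ∀ i, (G i).NonBlocking) :
    T.size ≤ (missionProduct T G rew).size := by
  have := T.finite
  have : Finite (missionProduct T G rew).Q := (missionProduct T G rew).finite
  have : Finite (T.S × (weightedBuchi G rew).Q) := this
  let start : ∀ i, (G i).Q := fun i => (G i).start
  have hQ := Nat.card_le_card_of_injective
    (fun s : T.S => ((s, start, none) : (missionProduct T G rew).Q))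
    (fun s s' h => (Prod.mk.inj h).1)
  choose next hnext using fun (σ : Set AP) i => hG i (start i) σ
  have hE := Nat.card_le_card_of_injective
    (fun e : {e : T.S × T.S // T.R e.1 e.2} =>
      (⟨((e.1.1, start, none), (e.1.2, next (T.label e.1.1), none)), e.2, hnext _, trivial⟩ :
        {e : (missionProduct T G rew).Q × (missionProduct T G rew).Q //
          (missionProduct T G rew).δ e.1 e.2}))
    (by
      rintro ⟨⟨s, t⟩, h⟩ ⟨⟨s', t'⟩, h'⟩ heq
      have heq := Prod.mk.inj (Subtype.mk.inj heq)
      obtain rfl := (Prod.mk.inj heq.1).1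
      obtain rfl := (Prod.mk.inj heq.2).1
      rfl)
  exact add_le_add hQ hE

theorem haltsWithin_missionInput (hG : ∀ i, (G i).NonBlocking) (hm : ∀ i, 1 ≤ (G i).m)
    (states : Listing (missionProduct T G rew).Q)
    (adj : AdjacencyLists (missionProduct T G rew).δ) (tadj : AdjacencyLists T.R) (threshold : ℕ) :
    ∃ t, t ≤ 51 * (missionProduct T G rew).size + 5 * (Nat.clog 2 (missionProduct T G rew).size *
        (missionProduct T G rew).size) + 9 ∧
      HaltsWithin (missionInput T G rew states adj tadj threshold) t := by
  classical
  have := T.finite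
  have := (missionProduct T G rew).finite
  have := Fintype.ofFinite T.S
  have := Fintype.ofFinite (missionProduct T G rew).Q
  let I := missionInput T G rew states adj tadj threshold
  have hsize : Fintype.card (missionProduct T G rew).Q + ∑ p, (I.succ p).length =
      (missionProduct T G rew).size := by
    rw [WeightedProduct.size, Nat.card_eq_fintype_card, ← adj.sum_length_succ]
    rfl
  have ht : ∑ s, ((I.tsucc s).length + 1) ≤ (missionProduct T G rew).size := by
    refine le_trans (le_of_eq ?_) (size_le_size_missionProduct hG)
    rw [TransitionSystem.size, Nat.card_eq_fintype_card, ← tadj.sum_length_succ,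
      Finset.sum_add_distrib, add_comm]
    simp [I, missionInput]
  have hacc : (Finset.univ.filter fun p => I.accepting p).card * (I.n + 1) ≤
      Fintype.card (missionProduct T G rew).Q := by
    have h := card_accepting_mul_le (T := T) (rew := rew) hm
    rw [Nat.card_eq_fintype_card, Nat.card_eq_fintype_card, Fintype.card_subtype] at h
    exact h
  have hstates : I.states.length = Fintype.card (missionProduct T G rew).Q := states.length_list
  refine ⟨_, ?_, haltsWithin_of_layered (missionInput_layered states adj tadj threshold)
    (N := (missionProduct T G rew).size) ((Nat.le_add_left _ _).trans_eq hsize)⟩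
  have h := searchTime_le hsize ht hacc
  change I.states.length + 1 + searchTime I _ ≤ _
  omega

end Mission

end WeightedNestedDFS

theorem clog_two_le_four_mul_log {N : ℕ} (hN : 2 ≤ N) : (Nat.clog 2 N : ℝ) ≤ 4 * Real.log N := by
  have h2 : (0.6931471803 : ℝ) < Real.log 2 := Real.log_two_gt_d9
  have hlog : Real.log 2 ≤ Real.log N := Real.log_le_log two_pos (by exact_mod_cast hN)
  obtain ⟨L, hL⟩ := Nat.exists_eq_add_of_le' (Nat.clog_pos one_lt_two hN)
  have hpow : (2 : ℝ) ^ L ≤ N := by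
    have := Nat.pow_pred_clog_lt_self one_lt_two (show 1 < N by omega)
    rw [hL] at this
    exact_mod_cast this.le
  have h : L * Real.log 2 ≤ Real.log N := by
    rw [← Real.log_pow]
    exact Real.log_le_log (by positivity) hpow
  have hL0 : (0 : ℝ) ≤ L := Nat.cast_nonneg L
  rw [hL]
  push_cast
  nlinarith

theorem mainTheorem2 :
    -- running time of the search on the product automaton
    (∃ C : ℝ, ∀ (AP : Type u) (n : ℕ) (T : TransitionSystem.{u, v} AP)
        (G : Fin n → GBA.{u, w} (Set AP)) (rew : Fin n → ℕ),
        (∀ i, (G i).NonBlocking) → (∀ i, 1 ≤ (G i).m) →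
        2 ≤ (missionProduct T G rew).size →
        ∀ (states : Listing (missionProduct T G rew).Q)
          (adj : AdjacencyLists (missionProduct T G rew).δ) (tadj : AdjacencyLists T.R)
          (threshold : ℕ),
        ∃ t : ℕ,
          (t : ℝ) ≤ C * ((missionProduct T G rew).size *
            Real.log ((missionProduct T G rew).size)) ∧
          WeightedNestedDFS.HaltsWithin
            (WeightedNestedDFS.missionInput T G rew states adj tadj threshold) t) ∧
    -- the translation is correct
    (∀ (AP : Type u) (φ : LTL AP),
        φ.toGBA.NonBlocking ∧ 1 ≤ φ.toGBA.m ∧ φ.toGBA.language = {x | φ.Sat x 0}) ∧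
    -- size of the product automaton
    (∃ C : ℕ, ∀ (AP : Type u) (n : ℕ) (T : TransitionSystem.{u, v} AP) (Φ : Fin n → LTL AP)
        (rew : Fin n → ℕ),
        (missionProduct T (fun i => (Φ i).toGBA) rew).size ≤
          C * T.size * 2 ^ (C * (∑ i, (Φ i).size +
            (Finset.univ.filter fun i => (Φ i).size = 0).card))) := by

  refine ⟨⟨150, fun AP n T G rew hG hm hsize states adj tadj threshold => ?_⟩,
    fun AP φ => ⟨φ.tableau.complete_nonBlocking, Nat.succ_pos _, φ.toGBA_language⟩,
    ⟨14, fun AP n T Φ rew => size_missionProduct_toGBA_le T Φ rew⟩⟩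
  obtain ⟨t, ht, hhalt⟩ :=
    WeightedNestedDFS.haltsWithin_missionInput hG hm states adj tadj threshold
  refine ⟨t, ?_, hhalt⟩
  generalize (missionProduct T G rew).size = N at ht hsize
  have ht' : (t : ℝ) ≤ 51 * N + 5 * (Nat.clog 2 N * N) + 9 := by exact_mod_cast ht
  have hN : (2 : ℝ) ≤ N := by exact_mod_cast hsize
  have h1 := mul_le_mul_of_nonneg_right (clog_two_le_four_mul_log hsize)
    (show (0 : ℝ) ≤ N by linarith)
  have hlog : (1 : ℝ) / 2 ≤ Real.log N := by
    have := Real.log_two_gt_d9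
    have := Real.log_le_log two_pos hN
    linarith
  have h2 := mul_le_mul_of_nonneg_left hlog (show (0 : ℝ) ≤ N by linarith)
  linarith
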